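/- Let $S$ be an oriented $C^\infty$-surface with boundary, and let $\gamma\colon[0,1]\to S$ be a curve: a $C^\infty$-immersion whose only singularities are transverse double points, with $\gamma^{-1}(\partial S)=\{0,1\}$ and $\gamma(0)\neq\gamma(1)$. Then $\gamma$ has finitely many double points; let $d$ be their number. **The diagram $D_\gamma$.** $D_\gamma$ is $\gamma([0,1])$ with each double point made into a crossing at which the strand traversed first is the overcrossing, oriented by $\gamma$. At a crossing choose positively oriented coordinates in which the overcrossing strand is the horizontal axis and the undercrossing strand is the vertical axis. The type $A$ splitting replaces the crossing, inside a small disc, by two disjoint arcs, one joining west to north and one joining south to east; the type $B$ splitting uses arcs joining west to south and north to east. A state $s$ of $D_\gamma$ is a choice of type $A$ or $B$ at each crossing; $\alpha(s)$ and $\beta(s)$ are the numbers of crossings of type $A$ and $B$, $D_\gamma(s)\subset S$ is the result of splitting every crossing according to $s$ (inside disjoint discs), and $\mu(s)$ is the number of connected components of $D_\gamma(s)$, which is positive and does not depend on the choices. Put $$\langle D_\gamma\rangle=\sum_s A^{\alpha(s)-\beta(s)}(-A^2-A^{-2})^{\mu(s)-1},\qquad \mathcal L_\gamma(A)=(-A)^{-3w(D_\gamma)}\langle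 D_\gamma\rangle\quad\text{in }\mathbb Z[A,A^{-1}],$$ where $w(D_\gamma)$ is the sum of the signs of the crossings, a crossing having sign $+1$ if the pair (tangent vector of the overcrossing strand, tangent vector of the undercrossing strand) is positively oriented and $-1$ otherwise. **The chord diagram $C_\gamma$.** Let $p_1<\dots<p_{2d}$ be the inverse images of the double points in $[0,1]$, and let $C_\gamma$ be the set of ordered pairs $(i,j)$ such that $\gamma(p_i)=\gamma(p_j)$ and $(\gamma'(p_i),\gamma'(p_j))$ is a positively oriented basis of the tangent plane. Then $C_\gamma$ is an oriented linear chord diagram of $d$ chords, that is, a set of $d$ ordered pairs whose entries make up $\{1,\dots,2d\}$. A chord $(i,j)$ is positive if $i<j$ and negative otherwise. For a state $s\colon C_\gamma\to\{A,B\}$ and a chord $c=(i,j)$ let $R_c$ be the set of transpositions of $\{0,\dots,2d\}$ (the identity when the two letters agree) $$R_c=\begin{cases}\{(i,\,j-1),\ (i-1,\,j)\}&\text{if } s(c)=A \text{ and } c \text{ is positive, or } s(c)=B \text{ and } c \text{ is negative},\\ \{(i,\,j),\ (i-1,\,j-1)\}&\text{otherwise},\end{cases}$$ and let $\Gamma_s$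 be the number of orbits on $\{0,\dots,2d\}$ of the group generated by $\bigcup_{c}R_c$. Put $$\langle C_\gamma\rangle=\sum_s A^{|s^{-1}(A)|-|s^{-1}(B)|}(-A^2-A^{-2})^{\Gamma_s-1},\qquad \mathcal L_{C_\gamma}(A)=(-A)^{-3w(C_\gamma)}\langle C_\gamma\rangle,$$ where $w(C_\gamma)$ is the number of positive chords minus the number of negative chords. **Claim.** $\langle D_\gamma\rangle=\langle C_\gamma\rangle$ and $\mathcal L_\gamma(A)=\mathcal L_{C_\gamma}(A)$. -/

import Mathlib

open Set Filter Topology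
open scoped Manifold ContDiff LaurentPolynomial

noncomputable section

/-! ### Oriented surfaces with boundary -/

/-- The ordered pair `(v, w)` is a basis of `T` that represents the orientation `o`. -/
def IsPositivePair {T : Type*} [AddCommGroup T] [Module ℝ T]
    (o : Orientation ℝ T (Fin 2)) (v w : T) : Prop :=
  ∃ b : Module.Basis (Fin 2) ℝ T, b 0 = v ∧ b 1 = w ∧ b.orientation = o

/-- An orientation of a smooth surface with boundary: an orientation of every tangent plane which,
read in the coordinates of the chart at any point `x₀`, is constant near `x₀`. -/
structure SurfaceOrientation (S : Type*) [TopologicalSpace S]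
    [ChartedSpace (EuclideanHalfSpace 2) S] [IsManifold (𝓡∂ 2) ∞ S] where
  /-- the orientation of the tangent plane at `x` -/
  at' : (x : S) → Orientation ℝ (TangentSpace (𝓡∂ 2) x) (Fin 2)
  locally_constant : ∀ x₀ : S, ∀ᶠ x in 𝓝 x₀, ∀ v w : EuclideanSpace ℝ (Fin 2),
    IsPositivePair (at' x) v w →
      IsPositivePair (at' x₀) (tangentCoordChange (𝓡∂ 2) x x₀ x v)
        (tangentCoordChange (𝓡∂ 2) x x₀ x w)

/-! ### Curves -/

section Curves

variable {S : Type*} [TopologicalSpace S] [ChartedSpace (EuclideanHalfSpace 2) S]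

/-- The velocity at time `t` of a path `γ` defined on `[0,1]`. It is an element of the tangent
space at `γ t`, which in Mathlib is the model space `ℝ²` through the preferred chart at `γ t`. -/
def pathVelocity (γ : ℝ → S) (t : ℝ) : EuclideanSpace ℝ (Fin 2) :=
  mfderivWithin 𝓘(ℝ, ℝ) (𝓡∂ 2) γ (Icc (0 : ℝ) 1) t (1 : ℝ)

end Curves

/-- A curve on `S`: a smooth immersion of `[0,1]` whose only singularities are transverse double
points, which meets `∂S` exactly at its two, distinct, endpoints. Only the restriction of `toFun`
to `[0,1]` is relevant. -/
structure SurfaceCurve (S : Type*) [TopologicalSpace S]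
    [ChartedSpace (EuclideanHalfSpace 2) S] where
  toFun : ℝ → S
  smooth : ContMDiffOn 𝓘(ℝ, ℝ) (𝓡∂ 2) ∞ toFun (Icc (0 : ℝ) 1)
  immersion : ∀ t ∈ Icc (0 : ℝ) 1, pathVelocity toFun t ≠ 0
  no_triple : ∀ t ∈ Icc (0 : ℝ) 1, ∀ u ∈ Icc (0 : ℝ) 1, ∀ v ∈ Icc (0 : ℝ) 1,
    toFun t = toFun u → toFun u = toFun v → t = u ∨ u = v ∨ t = v
  transverse : ∀ t ∈ Icc (0 : ℝ) 1, ∀ u ∈ Icc (0 : ℝ) 1, t ≠ u → toFun t = toFun u →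
    LinearIndependent ℝ ![pathVelocity toFun t, pathVelocity toFun u]
  mem_boundary_iff : ∀ t ∈ Icc (0 : ℝ) 1, toFun t ∈ (𝓡∂ 2).boundary S ↔ t = 0 ∨ t = 1
  endpoints_ne : toFun 0 ≠ toFun 1

/-! ### Diagrams, splittings, the bracket and the Kauffman-Jones polynomial -/

/-- The two types of splitting at a crossing. -/
inductive SplitType where
  | A : SplitType
  | B : SplitType

/-- The data of an oriented diagram on `S`: the underlying set, its crossings, and at every
crossing `p` the tangent vectors of the overcrossing and of the undercrossing strand
(the values of `overVec` and `underVec` away from the crossings are irrelevant). -/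
structure LinkDiagram (S : Type*) [TopologicalSpace S]
    [ChartedSpace (EuclideanHalfSpace 2) S] where
  carrier : Set S
  crossings : Set S
  overVec : (p : S) → TangentSpace (𝓡∂ 2) p
  underVec : (p : S) → TangentSpace (𝓡∂ 2) p

/-- The square `[-1,1] × [-1,1]`. -/
def modelSquare : Set (ℝ × ℝ) := Icc (-1 : ℝ) 1 ×ˢ Icc (-1 : ℝ) 1

/-- `a` is an arc (an injective continuous image of `[0,1]`) in the model square from `x` to `y`. -/
def IsModelArc (a : Set (ℝ × ℝ)) (x y : ℝ × ℝ) : Prop :=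
  a ⊆ modelSquare ∧ ∃ f : ℝ → ℝ × ℝ, ContinuousOn f (Icc (0 : ℝ) 1) ∧ InjOn f (Icc (0 : ℝ) 1) ∧
    f 0 = x ∧ f 1 = y ∧ f '' Icc (0 : ℝ) 1 = a

/-- Local models of the two splittings, in positively oriented coordinates in which the
overcrossing strand is the horizontal axis and the undercrossing strand the vertical one: two
disjoint arcs. In type `A`, which joins the two regions swept out by the overcrossing strand when
it is turned counterclockwise (the first and the third quadrant), they connect west to north and
south to east; in type `B` they connect west to south and north to east. -/
def IsModelSplitting : SplitType → Set (ℝ × ℝ) → Prop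
  | .A, m => ∃ a b : Set (ℝ × ℝ), IsModelArc a (-1, 0) (0, 1) ∧ IsModelArc b (0, -1) (1, 0) ∧
      Disjoint a b ∧ m = a ∪ b
  | .B, m => ∃ a b : Set (ℝ × ℝ), IsModelArc a (-1, 0) (0, -1) ∧ IsModelArc b (0, 1) (1, 0) ∧
      Disjoint a b ∧ m = a ∪ b

/-- The variable `A`, as a unit of `ℤ[A, A⁻¹]`. -/
def laurentA : (ℤ[T;T⁻¹])ˣ where
  val := LaurentPolynomial.T 1
  inv := LaurentPolynomial.T (-1)
  val_inv := by rw [← LaurentPolynomial.T_add]; simp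
  inv_val := by rw [← LaurentPolynomial.T_add]; simp

/-- `-A² - A⁻²`. -/
def loopValue : ℤ[T;T⁻¹] := -LaurentPolynomial.T 2 - LaurentPolynomial.T (-2)

namespace LinkDiagram

variable {S : Type*} [TopologicalSpace S] [ChartedSpace (EuclideanHalfSpace 2) S]

/-- `φ` gives smooth coordinates around the crossing `p`, defined in the interior of `S` and with
the model square in their range, which are positively oriented at `p` and in which `D` is the union
of the two axes, the overcrossing strand being tangent to the horizontal axis and the
undercrossing strand to the vertical one. -/
structure IsCrossingChart [IsManifold (𝓡∂ 2) ∞ S] (o : SurfaceOrientation S) (D : LinkDiagram S)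
    (p : S) (φ : OpenPartialHomeomorph S (ℝ × ℝ)) : Prop where
  mem_source : p ∈ φ.source
  map_center : φ p = 0
  source_subset : φ.source ⊆ (𝓡∂ 2).interior S
  square_subset : modelSquare ⊆ φ.target
  smooth : ContMDiffOn (𝓡∂ 2) 𝓘(ℝ, ℝ × ℝ) ∞ φ φ.source
  smooth_symm : ContMDiffOn 𝓘(ℝ, ℝ × ℝ) (𝓡∂ 2) ∞ φ.symm φ.target
  mem_carrier_iff : ∀ q ∈ φ.source, q ∈ D.carrier ↔ (φ q).1 = 0 ∨ (φ q).2 = 0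
  over_horizontal : ((mfderiv (𝓡∂ 2) 𝓘(ℝ, ℝ × ℝ) φ p (D.overVec p) : ℝ × ℝ)).2 = 0
  under_vertical : ((mfderiv (𝓡∂ 2) 𝓘(ℝ, ℝ × ℝ) φ p (D.underVec p) : ℝ × ℝ)).1 = 0
  oriented : ∀ v w : TangentSpace (𝓡∂ 2) p, IsPositivePair (o.at' p) v w →
    0 < ((mfderiv (𝓡∂ 2) 𝓘(ℝ, ℝ × ℝ) φ p v : ℝ × ℝ)).1 *
          ((mfderiv (𝓡∂ 2) 𝓘(ℝ, ℝ × ℝ) φ p w : ℝ × ℝ)).2 -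
        ((mfderiv (𝓡∂ 2) 𝓘(ℝ, ℝ × ℝ) φ p v : ℝ × ℝ)).2 *
          ((mfderiv (𝓡∂ 2) 𝓘(ℝ, ℝ × ℝ) φ p w : ℝ × ℝ)).1

/-- The closed disc in `S` that corresponds to the model square. -/
def disc (φ : OpenPartialHomeomorph S (ℝ × ℝ)) : Set S := φ.symm '' modelSquare

/-- A state of `D`: a choice of splitting type for each crossing. -/
abbrev State (D : LinkDiagram S) : Type _ := D.crossings → SplitType

/-- `E` is obtained by splitting `D` according to the state `s`: for suitable disjoint coordinate
discs around the crossings, `E` agrees with `D` outside of the discs, and within the disc around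
`p` it is the local model of type `s p`. -/
def IsSplitting [IsManifold (𝓡∂ 2) ∞ S] (o : SurfaceOrientation S) (D : LinkDiagram S)
    (s : D.State) (E : Set S) : Prop :=
  ∃ φ : D.crossings → OpenPartialHomeomorph S (ℝ × ℝ),
    (∀ p : D.crossings, D.IsCrossingChart o (p : S) (φ p)) ∧
    (∀ p q : D.crossings, p ≠ q → Disjoint (disc (φ p)) (disc (φ q))) ∧
    (∀ x : S, (∀ p : D.crossings, x ∉ disc (φ p)) → (x ∈ E ↔ x ∈ D.carrier)) ∧
    (∀ p : D.crossings, ∃ m, IsModelSplitting (s p) m ∧ E ∩ disc (φ p) = (φ p).symm '' m)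

/-- The split diagram `D(s)` (some set obtained by splitting `D` according to `s`). -/
def split [IsManifold (𝓡∂ 2) ∞ S] (o : SurfaceOrientation S) (D : LinkDiagram S) (s : D.State) :
    Set S :=
  Classical.epsilon (D.IsSplitting o s)

/-- `μ(s)`, the number of connected components of `D(s)`. -/
def mu [IsManifold (𝓡∂ 2) ∞ S] (o : SurfaceOrientation S) (D : LinkDiagram S) (s : D.State) : ℕ :=
  Nat.card (ConnectedComponents (D.split o s))

/-- `α(s)`, the number of type `A` splittings. -/
def alpha (D : LinkDiagram S) (s : D.State) : ℕ := Nat.card {p : D.crossings // s p = SplitType.A}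

/-- `β(s)`, the number of type `B` splittings. -/
def beta (D : LinkDiagram S) (s : D.State) : ℕ := Nat.card {p : D.crossings // s p = SplitType.B}

/-- The bracket polynomial `⟨D⟩`. -/
def bracket [IsManifold (𝓡∂ 2) ∞ S] (o : SurfaceOrientation S) (D : LinkDiagram S) : ℤ[T;T⁻¹] :=
  ∑ᶠ s : D.State,
    LaurentPolynomial.T ((D.alpha s : ℤ) - (D.beta s : ℤ)) * loopValue ^ (D.mu o s - 1)

open Classical in
/-- The sign of the crossing `p`. -/
def crossingSign [IsManifold (𝓡∂ 2) ∞ S] (o : SurfaceOrientation S) (D : LinkDiagram S) (p : S) :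
    ℤ :=
  if IsPositivePair (o.at' p) (D.overVec p) (D.underVec p) then 1 else -1

/-- The writhe `w(D)`. -/
def writhe [IsManifold (𝓡∂ 2) ∞ S] (o : SurfaceOrientation S) (D : LinkDiagram S) : ℤ :=
  ∑ᶠ p : D.crossings, D.crossingSign o (p : S)

/-- The Kauffman-Jones polynomial `(-A)^(-3 w(D)) ⟨D⟩`. -/
def jones [IsManifold (𝓡∂ 2) ∞ S] (o : SurfaceOrientation S) (D : LinkDiagram S) : ℤ[T;T⁻¹] :=
  (((-laurentA) ^ (-3 * D.writhe o) : (ℤ[T;T⁻¹])ˣ) : ℤ[T;T⁻¹]) * D.bracket o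

end LinkDiagram

/-! ### Oriented linear chord diagrams -/

/-- `C` is an oriented linear chord diagram of `d` chords. -/
def IsOrientedLinearChordDiagram (d : ℕ) (C : Set (ℕ × ℕ)) : Prop :=
  C.Finite ∧ C.ncard = d ∧ Prod.fst '' C ∪ Prod.snd '' C = Icc 1 (2 * d)

namespace ChordDiagram

/-- The transposition `(k, l)` of the letters `0, …, 2d` (the identity if `k = l`). -/
def transposition (d k l : ℕ) : Equiv.Perm (Fin (2 * d + 1)) :=
  Equiv.swap (Fin.ofNat (2 * d + 1) k) (Fin.ofNat (2 * d + 1) l)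

open Classical in
/-- The set `R_c` for a chord `c` with splitting type `σ`; the chord is positive if `c.1 < c.2`. -/
def R (d : ℕ) (c : ℕ × ℕ) (σ : SplitType) : Set (Equiv.Perm (Fin (2 * d + 1))) :=
  if (σ = SplitType.A ∧ c.1 < c.2) ∨ (σ = SplitType.B ∧ ¬ c.1 < c.2) then
    {transposition d c.1 (c.2 - 1), transposition d (c.1 - 1) c.2}
  else
    {transposition d c.1 c.2, transposition d (c.1 - 1) (c.2 - 1)}

/-- `Γ_s`, the number of orbits on `{0, …, 2d}` of the group generated by all the `R_c`. -/
def orbitCount (d : ℕ) (C : Set (ℕ × ℕ)) (s : C → SplitType) : ℕ :=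
  Nat.card (MulAction.orbitRel.Quotient
    (Subgroup.closure (⋃ c : C, R d (c : ℕ × ℕ) (s c))) (Fin (2 * d + 1)))

/-- `⟨C|s⟩`. -/
def stateBracket (d : ℕ) (C : Set (ℕ × ℕ)) (s : C → SplitType) : ℤ[T;T⁻¹] :=
  LaurentPolynomial.T ((Nat.card {c : C // s c = SplitType.A} : ℤ) -
      (Nat.card {c : C // s c = SplitType.B} : ℤ)) *
    loopValue ^ (orbitCount d C s - 1)

/-- `⟨C⟩`. -/
def bracket (d : ℕ) (C : Set (ℕ × ℕ)) : ℤ[T;T⁻¹] :=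
  ∑ᶠ s : C → SplitType, stateBracket d C s

/-- `w(C)`, the number of positive chords minus the number of negative chords. -/
def writhe (C : Set (ℕ × ℕ)) : ℤ :=
  ({c ∈ C | c.1 < c.2}.ncard : ℤ) - ({c ∈ C | ¬ c.1 < c.2}.ncard : ℤ)

/-- `(-A)^(-3 w(C)) ⟨C⟩`. -/
def jones (d : ℕ) (C : Set (ℕ × ℕ)) : ℤ[T;T⁻¹] :=
  (((-laurentA) ^ (-3 * writhe C) : (ℤ[T;T⁻¹])ˣ) : ℤ[T;T⁻¹]) * bracket d C

end ChordDiagram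

/-! ### The diagram and the chord diagram of a curve -/

namespace SurfaceCurve

variable {S : Type*} [TopologicalSpace S] [ChartedSpace (EuclideanHalfSpace 2) S]

/-- The double points of the curve. -/
def doublePoints (γ : SurfaceCurve S) : Set S :=
  {p | ∃ t ∈ Icc (0 : ℝ) 1, ∃ u ∈ Icc (0 : ℝ) 1, t ≠ u ∧ γ.toFun t = p ∧ γ.toFun u = p}

/-- `d(γ)`, the number of double points. -/
def numDoublePoints (γ : SurfaceCurve S) : ℕ := γ.doublePoints.ncard

/-- The first time in `[0,1]` at which the curve passes through `p`. -/
def firstTime (γ : SurfaceCurve S) (p : S) : ℝ := sInf {t ∈ Icc (0 : ℝ) 1 | γ.toFun t = p}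

/-- The last time in `[0,1]` at which the curve passes through `p`. -/
def lastTime (γ : SurfaceCurve S) (p : S) : ℝ := sSup {t ∈ Icc (0 : ℝ) 1 | γ.toFun t = p}

/-- The diagram `D_γ`: at each double point the strand traversed first is the overcrossing. -/
def diagram (γ : SurfaceCurve S) : LinkDiagram S where
  carrier := γ.toFun '' Icc (0 : ℝ) 1
  crossings := γ.doublePoints
  overVec p := pathVelocity γ.toFun (γ.firstTime p)
  underVec p := pathVelocity γ.toFun (γ.lastTime p)

/-- The inverse image in `[0,1]` of the double points. -/
def doubleTimes (γ : SurfaceCurve S) : Set ℝ := {t ∈ Icc (0 : ℝ) 1 | γ.toFun t ∈ γ.doublePoints}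

/-- The position of `t` among the times `p_1 < p_2 < ⋯ < p_{2d}` of the double points:
`timeIndex γ p_i = i`. -/
def timeIndex (γ : SurfaceCurve S) (t : ℝ) : ℕ := {u ∈ γ.doubleTimes | u ≤ t}.ncard

/-- The chord diagram `C_γ`: the pair `(i, j)` is a chord if and only if `γ(p_i) = γ(p_j)` and
`(γ'(p_i), γ'(p_j))` matches the orientation of `S`. -/
def chordDiagram [IsManifold (𝓡∂ 2) ∞ S] (o : SurfaceOrientation S) (γ : SurfaceCurve S) :
    Set (ℕ × ℕ) :=
  {c | ∃ t ∈ γ.doubleTimes, ∃ u ∈ γ.doubleTimes, γ.timeIndex t = c.1 ∧ γ.timeIndex u = c.2 ∧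
    γ.toFun t = γ.toFun u ∧
    IsPositivePair (o.at' (γ.toFun t)) (pathVelocity γ.toFun t) (pathVelocity γ.toFun u)}

end SurfaceCurve

end

/-! Both polynomials are sums over states, and crossings correspond to chords with the same signs.
So it suffices to compare, state by state, the number of components of the split curve with the
number of orbits on $\{0,\dots,2d\}$.

The double times cut $[0,1]$ into $2d+1$ intervals. The letter $n$ stands for the part of the curve
in the $n$-th interval that lies outside the open passages through the discs. If the curve passes
through a crossing at $p_i<p_j$, it enters the disc from the parts $i-1$ and $j-1$ and leaves it
into the parts $i$ and $j$. The two arcs of a splitting pair these four ends. Either each arc joins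
an entry to an exit of the other passage, which gives $(i,j-1)$ and $(i-1,j)$, or one arc joins the
entries and the other the exits, which gives $(i-1,j-1)$ and $(i,j)$. The first case occurs exactly
for type $A$ at a positive crossing and type $B$ at a negative one. This is `IsCoherent`;
`exists_isLocalSplitting` derives it from the directions in which the curve runs along the axes of a
crossing chart. For a negative chord the entries are $(j,i)$ instead of $(i,j)$, but both forms of
$R_c$ are invariant under that exchange (`R_chord`).

The split curve is therefore a finite union of compact connected pieces, and its components are the
classes of pieces under the relation generated by meeting (`card_connectedComponents_iUnion`).
Distinct outer pieces are disjoint, and so are distinct arcs; an outer piece meets an arc only in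
one of the ends above. Hence the classes are the orbits (`pieceClass_eq_of_nonempty`,
`eqvGen_of_pieceClass_eq`). The count applies to every splitting, so $\mu(s)$ does not depend on the
choices.

The analytic input is `exists_time_coordinates`: by transversality and the inverse function theorem,
the two passage times serve as coordinates around a double point. This yields crossing charts, and
enters the accumulation argument for the finiteness of the double points. -/

/-! ### Connected components of a finite union -/

/-- The connected components of a finite union of nonempty closed connected sets correspond to the
classes of the equivalence relation generated by intersecting. -/
theorem card_connectedComponents_iUnion {X ι Q : Type*} [TopologicalSpace X] [Finite ι]
    (P : ι → Set X) (hclosed : ∀ i, IsClosed (P i)) (hconn : ∀ i, IsConnected (P i))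
    (c : ι → Q) (hsurj : Function.Surjective c)
    (hmeet : ∀ i j, (P i ∩ P j).Nonempty → c i = c j)
    (hgen : ∀ i j, c i = c j → Relation.EqvGen (fun i j => (P i ∩ P j).Nonempty) i j) :
    Nat.card (ConnectedComponents (⋃ i, P i : Set X)) = Nat.card Q := by
  classical
  set E : Set X := ⋃ i, P i with hE
  -- With $Q$ discrete, the class function is continuous because it is constant on each member of a
  -- finite closed cover; so it descends to components.
  let _ : TopologicalSpace Q := ⊥
  have : DiscreteTopology Q := ⟨rfl⟩
  have hex : ∀ x : E, ∃ i, (x : X) ∈ P i := fun x => mem_iUnion.1 x.2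
  choose k hk using hex
  let g : E → Q := fun x => c (k x)
  have hg : ∀ (x : E) i, (x : X) ∈ P i → g x = c i := fun x i hi => hmeet _ _ ⟨x, hk x, hi⟩
  have hgc : Continuous g := by
    have hlf : LocallyFinite fun i => ((↑) : E → X) ⁻¹' P i := locallyFinite_of_finite _
    refine hlf.continuous ?_ (fun i => (hclosed i).preimage continuous_subtype_val) ?_
    · ext x; simpa using ⟨k x, hk x⟩
    · intro i
      exact continuousOn_const.congr (fun x hx => hg x i hx)
  choose y hy using fun i => (hconn i).nonempty
  have hyE : ∀ i, y i ∈ E := fun i => mem_iUnion.2 ⟨i, hy i⟩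
  let f : ι → ConnectedComponents E := fun i => ConnectedComponents.mk ⟨y i, hyE i⟩
  have hf : ∀ (x : E) i, (x : X) ∈ P i → ConnectedComponents.mk x = f i := by
    intro x i hi
    refine ConnectedComponents.coe_eq_coe'.2 ?_
    have hpre : IsPreconnected (((↑) : E → X) ⁻¹' P i) := by
      refine (Topology.IsInducing.subtypeVal.isPreconnected_image).1 ?_
      rw [image_preimage_eq_of_subset]
      · exact (hconn i).isPreconnected
      · rw [Subtype.range_coe]; exact subset_iUnion P i
    exact hpre.subset_connectedComponent (show (⟨y i, hyE i⟩ : E) ∈ _ from hy i) hi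
  have hfc : ∀ i j, c i = c j → f i = f j := by
    intro i j hij
    have := hgen i j hij
    induction this with
    | rel i j h =>
      obtain ⟨x, hxi, hxj⟩ := h
      rw [← hf ⟨x, mem_iUnion.2 ⟨i, hxi⟩⟩ i hxi, ← hf ⟨x, mem_iUnion.2 ⟨i, hxi⟩⟩ j hxj]
    | refl => rfl
    | symm i j h ih =>
      exact (ih hij.symm).symm
    | trans i j l h₁ h₂ ih₁ ih₂ =>
      have h : ∀ a b, Relation.EqvGen (fun i j => (P i ∩ P j).Nonempty) a b → c a = c b := by
        intro a b hab
        induction hab with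
        | rel a b h => exact hmeet _ _ h
        | refl => rfl
        | symm a b _ ih => exact ih.symm
        | trans a b d _ _ ih₁ ih₂ => exact ih₁.trans ih₂
      exact (ih₁ (h _ _ h₁)).trans (ih₂ (h _ _ h₂))
  refine Nat.card_congr (Equiv.ofBijective hgc.connectedComponentsLift ⟨?_, ?_⟩)
  · intro a b hab
    obtain ⟨x, rfl⟩ := ConnectedComponents.surjective_coe a
    obtain ⟨z, rfl⟩ := ConnectedComponents.surjective_coe b
    rw [hgc.connectedComponentsLift_apply_coe, hgc.connectedComponentsLift_apply_coe] at hab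
    rw [hf x _ (hk x), hf z _ (hk z)]
    exact hfc _ _ hab
  · intro q
    obtain ⟨i, rfl⟩ := hsurj q
    refine ⟨f i, ?_⟩
    rw [hgc.connectedComponentsLift_apply_coe]
    exact hg _ i (hy i)

/-! ### Compact sets of reals that biject continuously onto an interval -/

/-- On a compact set a continuous injection is closed, so the inverse is continuous and $J$ is
connected, hence an interval. A continuous injection on an interval is strictly monotone, and
surjectivity fixes the values at the ends. -/
theorem exists_eq_Icc_of_bijOn {J : Set ℝ} (hJ : IsCompact J) {h : ℝ → ℝ} (hc : ContinuousOn h J)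
    (hb : BijOn h J (Icc (-1) 1)) :
    ∃ a b : ℝ, a < b ∧ J = Icc a b ∧
      ((StrictMonoOn h (Icc a b) ∧ h a = -1 ∧ h b = 1) ∨
        (StrictAntiOn h (Icc a b) ∧ h a = 1 ∧ h b = -1)) := by
  have hconn : IsConnected J := by
    have hg : ContinuousOn (Function.invFunOn h J) (Icc (-1) 1) := by
      rw [← hb.image_eq]
      have hli : LeftInvOn (Function.invFunOn h J) h J := hb.injOn.leftInvOn_invFunOn
      refine continuousOn_iff_isClosed.2 fun t ht => ⟨h '' (t ∩ J), ?_, ?_⟩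
      · exact ((hJ.inter_left ht).image_of_continuousOn (hc.mono inter_subset_right)).isClosed
      · ext z
        constructor
        · rintro ⟨hz, x, hx, rfl⟩
          rw [mem_preimage, hli hx] at hz
          exact ⟨⟨x, ⟨hz, hx⟩, rfl⟩, ⟨x, hx, rfl⟩⟩
        · rintro ⟨⟨x, ⟨hxt, hx⟩, rfl⟩, -⟩
          refine ⟨?_, ⟨x, hx, rfl⟩⟩
          rw [mem_preimage, hli hx]; exact hxt
    have himg : Function.invFunOn h J '' Icc (-1) 1 = J := by
      rw [← hb.image_eq, hb.injOn.leftInvOn_invFunOn.image_image]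
    rw [← himg]
    exact (isConnected_Icc (by norm_num)).image _ hg
  have hJI : J = Icc (sInf J) (sSup J) := eq_Icc_of_connected_compact hconn hJ
  set a := sInf J
  set b := sSup J
  have hab : a < b := by
    by_contra hle
    have hsub : J.Subsingleton := by
      rw [hJI]; exact subsingleton_Icc_of_ge (not_lt.1 hle)
    have : (Icc (-1 : ℝ) 1).Subsingleton := by rw [← hb.image_eq]; exact hsub.image h
    have := this (left_mem_Icc.2 (by norm_num)) (right_mem_Icc.2 (by norm_num))
    norm_num at this
  rw [hJI] at hc hb
  refine ⟨a, b, hab, hJI, ?_⟩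
  have ha : a ∈ Icc a b := left_mem_Icc.2 hab.le
  have hbm : b ∈ Icc a b := right_mem_Icc.2 hab.le
  obtain ⟨x, hx, hx1⟩ := hb.surjOn (left_mem_Icc.2 (by norm_num : (-1 : ℝ) ≤ 1))
  obtain ⟨y, hy, hy1⟩ := hb.surjOn (right_mem_Icc.2 (by norm_num : (-1 : ℝ) ≤ 1))
  rcases hc.strictMonoOn_of_injOn_Icc' hab.le hb.injOn with hm | hm
  · refine Or.inl ⟨hm, le_antisymm ?_ (hb.mapsTo ha).1, le_antisymm (hb.mapsTo hbm).2 ?_⟩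
    · rw [← hx1]; exact hm.monotoneOn ha hx hx.1
    · rw [← hy1]; exact hm.monotoneOn hy hbm hy.2
  · refine Or.inr ⟨hm, le_antisymm (hb.mapsTo ha).2 ?_, le_antisymm ?_ (hb.mapsTo hbm).1⟩
    · rw [← hy1]; exact hm.antitoneOn ha hy hy.1
    · rw [← hx1]; exact hm.antitoneOn hx hbm hx.2

/-- The sign of the derivative at a zero tells in which direction a continuous bijection from a
compact set of reals onto `[-1,1]` runs. -/
theorem exists_eq_Icc_of_bijOn_of_deriv {J : Set ℝ} (hJ : IsCompact J) {h : ℝ → ℝ}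
    (hc : ContinuousOn h J) (hb : BijOn h J (Icc (-1) 1)) {t : ℝ} (ht : t ∈ J) (ht0 : h t = 0)
    {κ : ℝ} (hd : HasDerivAt h κ t) :
    ∃ a b : ℝ, a < t ∧ t < b ∧ J = Icc a b ∧ (0 < κ → h a = -1 ∧ h b = 1) ∧
      (κ < 0 → h a = 1 ∧ h b = -1) := by
  obtain ⟨a, b, hab, hJI, h'⟩ := exists_eq_Icc_of_bijOn hJ hc hb
  have htI : t ∈ Icc a b := hJI ▸ ht
  have hat : a < t := by
    refine lt_of_le_of_ne htI.1 ?_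
    rintro rfl
    rcases h' with ⟨_, h1, _⟩ | ⟨_, h1, _⟩ <;> rw [h1] at ht0 <;> norm_num at ht0
  have htb : t < b := by
    refine lt_of_le_of_ne htI.2 ?_
    rintro rfl
    rcases h' with ⟨_, _, h1⟩ | ⟨_, _, h1⟩ <;> rw [h1] at ht0 <;> norm_num at ht0
  have hnhds : Icc a b ∈ 𝓝 t := Icc_mem_nhds hat htb
  refine ⟨a, b, hat, htb, hJI, fun hκ => ?_, fun hκ => ?_⟩
  · rcases h' with ⟨_, h1⟩ | ⟨hm, h1⟩
    · exact h1
    -- The wrong monotonicity would give the derivative at $t$ the wrong sign.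
    · exfalso
      have := hm.antitoneOn.derivWithin_nonpos (x := t)
      rw [(hd.hasDerivWithinAt).derivWithin
        (uniqueDiffWithinAt_of_mem_nhds hnhds)] at this
      linarith
  · rcases h' with ⟨hm, h1⟩ | ⟨_, h1⟩
    · exfalso
      have := hm.monotoneOn.derivWithin_nonneg (x := t)
      rw [(hd.hasDerivWithinAt).derivWithin
        (uniqueDiffWithinAt_of_mem_nhds hnhds)] at this
      linarith
    · exact h1

/-! ### Positively oriented pairs -/

section PositivePairs

variable {V : Type*} [AddCommGroup V] [Module ℝ V]

/-- The determinant of the images of a pair of vectors under a linear map to the plane. -/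
def planeDet (L : V →ₗ[ℝ] ℝ × ℝ) (v w : V) : ℝ := (L v).1 * (L w).2 - (L v).2 * (L w).1

/-- The determinant of the images under `L`, as an alternating form. -/
noncomputable def planeDetForm (L : V →ₗ[ℝ] ℝ × ℝ) : V [⋀^Fin 2]→ₗ[ℝ] ℝ :=
  ((Module.Basis.finTwoProd ℝ).det).compLinearMap L

theorem planeDetForm_apply (L : V →ₗ[ℝ] ℝ × ℝ) (v w : V) :
    planeDetForm L ![v, w] = planeDet L v w := by
  simp [planeDetForm, planeDet, Module.Basis.det_apply, Matrix.det_fin_two,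
    Module.Basis.toMatrix_apply]
  ring

/-- Alternating 2-forms on a plane are multiples of `b.det`; the factor is found by evaluating at
`b`. -/
theorem planeDet_eq_det_mul (L : V →ₗ[ℝ] ℝ × ℝ) (b : Module.Basis (Fin 2) ℝ V) (v w : V) :
    planeDet L v w = planeDet L (b 0) (b 1) * b.det ![v, w] := by
  rw [← planeDetForm_apply, ← planeDetForm_apply]
  conv_lhs => rw [(planeDetForm L).eq_smul_basis_det b]
  have : (b : Fin 2 → V) = ![b 0, b 1] := by ext i; fin_cases i <;> rfl
  rw [this]
  simp

theorem IsPositivePair.linearIndependent {o : Orientation ℝ V (Fin 2)} {v w : V}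
    (h : IsPositivePair o v w) : LinearIndependent ℝ ![v, w] := by
  obtain ⟨b, rfl, rfl, -⟩ := h
  have : (b : Fin 2 → V) = ![b 0, b 1] := by ext i; fin_cases i <;> rfl
  rw [← this]; exact b.linearIndependent

theorem IsPositivePair.det_pos {b : Module.Basis (Fin 2) ℝ V} {v w : V}
    (h : IsPositivePair b.orientation v w) : 0 < b.det ![v, w] := by
  obtain ⟨b', rfl, rfl, hb⟩ := h
  have : (b' : Fin 2 → V) = ![b' 0, b' 1] := by ext i; fin_cases i <;> rfl
  rw [← this]
  exact (b.orientation_eq_iff_det_pos b').1 hb.symm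

/-- The basis made up of two linearly independent vectors of a plane. -/
noncomputable def pairBasis (hV : Module.finrank ℝ V = 2) {v w : V}
    (h : LinearIndependent ℝ ![v, w]) : Module.Basis (Fin 2) ℝ V :=
  basisOfLinearIndependentOfCardEqFinrank h (by simp [hV])

theorem isPositivePair_of_det_pos (hV : Module.finrank ℝ V = 2) {b : Module.Basis (Fin 2) ℝ V}
    {v w : V} (h : 0 < b.det ![v, w]) : IsPositivePair b.orientation v w := by
  have hu : IsUnit (b.det ![v, w]) := (ne_of_gt h).isUnit
  have hli := (b.is_basis_iff_det.2 hu).1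
  refine ⟨pairBasis hV hli, by simp [pairBasis], by simp [pairBasis], ?_⟩
  symm
  rw [b.orientation_eq_iff_det_pos]
  simpa [pairBasis] using h

theorem Orientation.exists_basis (hV : Module.finrank ℝ V = 2) (o : Orientation ℝ V (Fin 2)) :
    ∃ b : Module.Basis (Fin 2) ℝ V, b.orientation = o := by
  have : FiniteDimensional ℝ V := Module.finite_of_finrank_eq_succ hV
  let b := (Module.finBasis ℝ V).reindex (finCongr hV)
  exact ⟨b.adjustToOrientation o, b.orientation_adjustToOrientation o⟩

/-- Of two linearly independent vectors, exactly one of the two orderings is positive. -/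
theorem isPositivePair_swap_iff (hV : Module.finrank ℝ V = 2) (o : Orientation ℝ V (Fin 2))
    {v w : V} (h : LinearIndependent ℝ ![v, w]) :
    IsPositivePair o w v ↔ ¬ IsPositivePair o v w := by
  obtain ⟨b, rfl⟩ := o.exists_basis hV
  have hswap : b.det ![w, v] = - b.det ![v, w] := by
    have h2 := b.det.map_swap ![v, w] (i := 0) (j := 1) (by decide)
    rw [← h2]; congr 1; ext i; fin_cases i <;> simp
  have hne : b.det ![v, w] ≠ 0 := by
    have : IsUnit (b.det ![v, w]) := by
      refine b.is_basis_iff_det.1 ⟨h, ?_⟩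
      exact h.span_eq_top_of_card_eq_finrank (by simp [hV])
    exact this.ne_zero
  constructor
  · intro h1 h2
    have := h1.det_pos; have := h2.det_pos
    linarith
  · intro h1
    refine isPositivePair_of_det_pos hV ?_
    by_contra h3
    refine h1 (isPositivePair_of_det_pos hV ?_)
    rw [hswap] at h3
    exact lt_of_le_of_ne (by linarith) hne.symm

/-- A linear map to the plane which is positive on one positive pair is so on all of them. -/
theorem IsPositivePair.planeDet_pos {o : Orientation ℝ V (Fin 2)} {v w x y : V}
    (h : IsPositivePair o v w) (h' : IsPositivePair o x y) (L : V →ₗ[ℝ] ℝ × ℝ)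
    (hL : 0 < planeDet L v w) : 0 < planeDet L x y := by
  obtain ⟨b, rfl, rfl, rfl⟩ := h
  rw [planeDet_eq_det_mul L b]
  exact mul_pos hL h'.det_pos

end PositivePairs

/-! ### Times and velocities of a curve at its double points -/

namespace SurfaceCurve

variable {S : Type*} [TopologicalSpace S] [ChartedSpace (EuclideanHalfSpace 2) S]
  (γ : SurfaceCurve S)

theorem continuousOn : ContinuousOn γ.toFun (Icc 0 1) := γ.smooth.continuousOn

/-- If $t$ were an end of $[0,1]$, the common image would lie on the boundary, so $u$ would be an
end as well; but the two ends have different images. -/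
theorem isDoublePair_mem_Ioo {t u : ℝ} (ht : t ∈ Icc (0 : ℝ) 1) (hu : u ∈ Icc (0 : ℝ) 1)
    (htu : t ≠ u) (h : γ.toFun t = γ.toFun u) : t ∈ Ioo (0 : ℝ) 1 := by
  by_contra hn
  have h01 : t = 0 ∨ t = 1 := by
    by_contra h'
    push Not at h'
    exact hn ⟨lt_of_le_of_ne ht.1 h'.1.symm, lt_of_le_of_ne ht.2 h'.2⟩
  have hb := (γ.mem_boundary_iff t ht).2 h01
  rw [h] at hb
  have h01' := (γ.mem_boundary_iff u hu).1 hb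
  rcases h01 with rfl | rfl <;> rcases h01' with rfl | rfl
  · exact htu rfl
  · exact γ.endpoints_ne h
  · exact γ.endpoints_ne h.symm
  · exact htu rfl

/-- The absence of triple points leaves exactly two times. This is what makes the infimum and
supremum in `firstTime` and `lastTime` attained and distinct. -/
theorem exists_times {p : S} (hp : p ∈ γ.doublePoints) :
    ∃ t u : ℝ, 0 < t ∧ t < u ∧ u < 1 ∧
      {s ∈ Icc (0 : ℝ) 1 | γ.toFun s = p} = {t, u} := by
  have key : ∀ t ∈ Icc (0 : ℝ) 1, ∀ u ∈ Icc (0 : ℝ) 1, t < u → γ.toFun t = p → γ.toFun u = p →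
      ∃ t u : ℝ, 0 < t ∧ t < u ∧ u < 1 ∧ {s ∈ Icc (0 : ℝ) 1 | γ.toFun s = p} = {t, u} := by
    intro t ht u hu htu htp hup
    refine ⟨t, u, (γ.isDoublePair_mem_Ioo ht hu htu.ne (htp.trans hup.symm)).1, htu,
      (γ.isDoublePair_mem_Ioo hu ht htu.ne' (hup.trans htp.symm)).2, ?_⟩
    ext s
    constructor
    · rintro ⟨hs, hsp⟩
      rcases γ.no_triple s hs t ht u hu (hsp.trans htp.symm) (htp.trans hup.symm) with h | h | h
      · exact Or.inl h
      · exact absurd h htu.ne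
      · exact Or.inr h
    · rintro (rfl | rfl)
      · exact ⟨ht, htp⟩
      · exact ⟨hu, hup⟩
  obtain ⟨t, ht, u, hu, htu, htp, hup⟩ := hp
  rcases htu.lt_or_gt with h | h
  · exact key t ht u hu h htp hup
  · exact key u hu t ht h hup htp

variable {γ}

theorem setOf_apply_eq {p : S} (hp : p ∈ γ.doublePoints) :
    {s ∈ Icc (0 : ℝ) 1 | γ.toFun s = p} = {γ.firstTime p, γ.lastTime p} := by
  obtain ⟨t, u, -, htu, -, h⟩ := γ.exists_times hp
  rw [firstTime, lastTime, h, csInf_pair, csSup_pair, inf_eq_left.2 htu.le, sup_eq_right.2 htu.le]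

theorem times_lt {p : S} (hp : p ∈ γ.doublePoints) :
    0 < γ.firstTime p ∧ γ.firstTime p < γ.lastTime p ∧ γ.lastTime p < 1 := by
  obtain ⟨t, u, ht, htu, hu, h⟩ := γ.exists_times hp
  rw [firstTime, lastTime, h, csInf_pair, csSup_pair, inf_eq_left.2 htu.le, sup_eq_right.2 htu.le]
  exact ⟨ht, htu, hu⟩

theorem apply_firstTime {p : S} (hp : p ∈ γ.doublePoints) : γ.toFun (γ.firstTime p) = p := by
  have : γ.firstTime p ∈ {s ∈ Icc (0 : ℝ) 1 | γ.toFun s = p} := by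
    rw [setOf_apply_eq hp]; exact Or.inl rfl
  exact this.2

theorem apply_lastTime {p : S} (hp : p ∈ γ.doublePoints) : γ.toFun (γ.lastTime p) = p := by
  have : γ.lastTime p ∈ {s ∈ Icc (0 : ℝ) 1 | γ.toFun s = p} := by
    rw [setOf_apply_eq hp]; exact Or.inr rfl
  exact this.2

theorem firstTime_mem_Ioo {p : S} (hp : p ∈ γ.doublePoints) : γ.firstTime p ∈ Ioo (0 : ℝ) 1 :=
  ⟨(times_lt hp).1, (times_lt hp).2.1.trans (times_lt hp).2.2⟩

theorem lastTime_mem_Ioo {p : S} (hp : p ∈ γ.doublePoints) : γ.lastTime p ∈ Ioo (0 : ℝ) 1 :=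
  ⟨(times_lt hp).1.trans (times_lt hp).2.1, (times_lt hp).2.2⟩

theorem eq_firstTime_or_lastTime {p : S} (hp : p ∈ γ.doublePoints) {s : ℝ}
    (hs : s ∈ Icc (0 : ℝ) 1) (h : γ.toFun s = p) : s = γ.firstTime p ∨ s = γ.lastTime p := by
  have : s ∈ {s ∈ Icc (0 : ℝ) 1 | γ.toFun s = p} := ⟨hs, h⟩
  rw [setOf_apply_eq hp] at this
  exact this

theorem eq_of_apply_eq_of_notMem {s t : ℝ} (hs : s ∈ Icc (0 : ℝ) 1) (ht : t ∈ Icc (0 : ℝ) 1)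
    (h : γ.toFun s = γ.toFun t) (hd : γ.toFun s ∉ γ.doublePoints) : s = t := by
  by_contra hne
  exact hd ⟨s, hs, t, ht, hne, rfl, h.symm⟩

theorem linearIndependent_velocity {p : S} (hp : p ∈ γ.doublePoints) :
    LinearIndependent ℝ ![pathVelocity γ.toFun (γ.firstTime p),
      pathVelocity γ.toFun (γ.lastTime p)] :=
  γ.transverse _ (Ioo_subset_Icc_self (firstTime_mem_Ioo hp)) _
    (Ioo_subset_Icc_self (lastTime_mem_Ioo hp)) (times_lt hp).2.1.ne
    ((apply_firstTime hp).trans (apply_lastTime hp).symm)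

theorem mem_interior_of_mem_Ioo {t : ℝ} (ht : t ∈ Ioo (0 : ℝ) 1) :
    γ.toFun t ∈ (𝓡∂ 2).interior S := by
  rw [← ModelWithCorners.compl_boundary (I := 𝓡∂ 2) (M := S)]
  intro h
  rcases (γ.mem_boundary_iff t (Ioo_subset_Icc_self ht)).1 h with rfl | rfl
  · exact lt_irrefl _ ht.1
  · exact lt_irrefl _ ht.2

theorem mem_interior_of_mem_doublePoints {p : S} (hp : p ∈ γ.doublePoints) :
    p ∈ (𝓡∂ 2).interior S := by
  have := mem_interior_of_mem_Ioo (γ := γ) (firstTime_mem_Ioo hp)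
  rwa [apply_firstTime hp] at this

theorem hasMFDerivWithinAt {t : ℝ} (ht : t ∈ Icc (0 : ℝ) 1) :
    HasMFDerivWithinAt 𝓘(ℝ, ℝ) (𝓡∂ 2) γ.toFun (Icc (0 : ℝ) 1) t
      (mfderivWithin 𝓘(ℝ, ℝ) (𝓡∂ 2) γ.toFun (Icc (0 : ℝ) 1) t) :=
  ((γ.smooth t ht).mdifferentiableWithinAt (by simp)).hasMFDerivWithinAt

/-- The curve in the preferred chart at one of its points. -/
theorem hasDerivWithinAt_extChartAt {t : ℝ} (ht : t ∈ Icc (0 : ℝ) 1) :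
    HasDerivWithinAt (extChartAt (𝓡∂ 2) (γ.toFun t) ∘ γ.toFun) (pathVelocity γ.toFun t)
      (Icc (0 : ℝ) 1) t := by
  have h := (hasMFDerivWithinAt (γ := γ) ht).2
  simp only [writtenInExtChartAt, extChartAt_model_space_eq_id, PartialEquiv.refl_symm,
    PartialEquiv.refl_coe, Function.comp_id, preimage_id_eq, id_eq, modelWithCornersSelf_coe,
    range_id, inter_univ] at h
  exact HasFDerivWithinAt.hasDerivWithinAt h

/-- The chain rule for a curve read in coordinates. -/
theorem hasDerivAt_comp {E : Type*} [NormedAddCommGroup E] [NormedSpace ℝ E] {φ : S → E}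
    {t : ℝ} (ht : t ∈ Ioo (0 : ℝ) 1) (hφ : MDifferentiableAt (𝓡∂ 2) 𝓘(ℝ, E) φ (γ.toFun t)) :
    HasDerivAt (φ ∘ γ.toFun)
      (mfderiv (𝓡∂ 2) 𝓘(ℝ, E) φ (γ.toFun t) (pathVelocity γ.toFun t)) t := by
  have h := hφ.hasMFDerivAt.comp_hasMFDerivWithinAt t
    (hasMFDerivWithinAt (γ := γ) (Ioo_subset_Icc_self ht))
  let L : ℝ →L[ℝ] E := (mfderiv (𝓡∂ 2) 𝓘(ℝ, E) φ (γ.toFun t)).comp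
    (mfderivWithin 𝓘(ℝ, ℝ) (𝓡∂ 2) γ.toFun (Icc (0 : ℝ) 1) t)
  have h' : HasFDerivWithinAt (φ ∘ γ.toFun) L (Icc (0 : ℝ) 1) t :=
    hasMFDerivWithinAt_iff_hasFDerivWithinAt.1 h
  exact h'.hasDerivWithinAt.hasDerivAt (Icc_mem_nhds ht.1 ht.2)

theorem contDiffWithinAt_extChartAt [IsManifold (𝓡∂ 2) ∞ S] {t : ℝ} (ht : t ∈ Icc (0 : ℝ) 1)
    {p : S} (hp : γ.toFun t ∈ (chartAt (EuclideanHalfSpace 2) p).source) :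
    ContDiffWithinAt ℝ ∞ (extChartAt (𝓡∂ 2) p ∘ γ.toFun) (Icc (0 : ℝ) 1) t := by
  rw [← contMDiffWithinAt_iff_contDiffWithinAt]
  exact (contMDiffAt_extChartAt' hp).comp_contMDiffWithinAt t (γ.smooth t ht)

/-- A curve is injective near every time. -/
theorem exists_injOn [IsManifold (𝓡∂ 2) ∞ S] {t : ℝ} (ht : t ∈ Icc (0 : ℝ) 1) :
    ∃ V ∈ 𝓝 t, InjOn γ.toFun (V ∩ Icc (0 : ℝ) 1) := by
  set c := extChartAt (𝓡∂ 2) (γ.toFun t) ∘ γ.toFun with hc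
  set v := pathVelocity γ.toFun t with hv
  -- The component of the curve along its own velocity at $t$ has derivative $\|v\|^2>0$ there,
  -- hence is strictly increasing nearby.
  let g : ℝ → ℝ := fun s => inner ℝ v (c s)
  have hcd : ContDiffWithinAt ℝ 1 c (Icc (0 : ℝ) 1) t :=
    (contDiffWithinAt_extChartAt ht (mem_chart_source _ _)).of_le (by simp)
  have hgd : ContDiffWithinAt ℝ 1 g (Icc (0 : ℝ) 1) t := contDiffWithinAt_const.inner ℝ hcd
  obtain ⟨u, hu, -, hgu⟩ := hgd.contDiffOn le_rfl (by simp)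
  rw [insert_eq_of_mem ht] at hu
  obtain ⟨ε, hε, hball⟩ := Metric.mem_nhdsWithin_iff.1 hu
  have hg' : HasDerivWithinAt g (inner ℝ v v) (Icc (0 : ℝ) 1) t := by
    have h1 := hasDerivWithinAt_extChartAt (γ := γ) ht
    have h2 := ((innerSL ℝ v).hasFDerivAt (x := c t)).comp_hasDerivWithinAt t h1
    exact h2
  have hpos : 0 < inner ℝ v v := by
    rw [real_inner_self_eq_norm_sq]
    have := norm_pos_iff.2 (γ.immersion t ht)
    positivity
  -- Clipping at $0$ and $1$ allows $t$ to be an end of the interval; derivatives are then taken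
  -- within $[a,b]$.
  set a := max 0 (t - ε / 2) with ha
  set b := min 1 (t + ε / 2) with hb
  have hab : a < b := by
    rw [ha, hb, max_lt_iff, lt_min_iff, lt_min_iff]
    refine ⟨⟨by norm_num, ?_⟩, ?_, ?_⟩ <;> linarith [ht.1, ht.2]
  have hsub : Icc a b ⊆ Metric.ball t ε ∩ Icc (0 : ℝ) 1 := by
    intro s hs
    obtain ⟨h1, h2⟩ := hs
    rw [ha, max_le_iff] at h1
    rw [hb, le_min_iff] at h2
    refine ⟨?_, h1.1, h2.1⟩
    rw [Metric.mem_ball, Real.dist_eq, abs_lt]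
    constructor <;> linarith
  have htab : t ∈ Icc a b := by
    refine ⟨max_le ht.1 (by linarith), le_min ht.2 (by linarith)⟩
  have hgab : ContDiffOn ℝ 1 g (Icc a b) := hgu.mono (hsub.trans hball)
  have hder : derivWithin g (Icc a b) t = inner ℝ v v :=
    (hg'.mono (fun s hs => (hsub hs).2)).derivWithin (uniqueDiffOn_Icc hab t htab)
  have hcont := hgab.continuousOn_derivWithin (uniqueDiffOn_Icc hab) le_rfl
  have hev : ∀ᶠ s in 𝓝[Icc a b] t, 0 < derivWithin g (Icc a b) s := by
    have := (hcont t htab).eventually (lt_mem_nhds (hder.symm ▸ hpos))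
    exact this
  obtain ⟨δ, hδ, hδ'⟩ := Metric.mem_nhdsWithin_iff.1 hev
  have hconv : Convex ℝ (Metric.ball t δ ∩ Icc a b) := (convex_ball t δ).inter (convex_Icc a b)
  have hmono : StrictMonoOn g (Metric.ball t δ ∩ Icc a b) := by
    refine strictMonoOn_of_deriv_pos hconv (hgab.continuousOn.mono inter_subset_right) ?_
    intro s hs
    have hs' := interior_subset hs
    have hn : Icc a b ∈ 𝓝 s := mem_of_superset (mem_interior_iff_mem_nhds.1 hs) inter_subset_right
    rw [← derivWithin_of_mem_nhds hn]
    exact hδ' hs'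
  refine ⟨Metric.ball t δ ∩ Ioo (t - ε / 2) (t + ε / 2), inter_mem (Metric.ball_mem_nhds _ hδ)
    (Ioo_mem_nhds (by linarith) (by linarith)), ?_⟩
  rintro x ⟨⟨hx1, hx2⟩, hx3⟩ y ⟨⟨hy1, hy2⟩, hy3⟩ hxy
  refine hmono.injOn ⟨hx1, max_le hx3.1 hx2.1.le, le_min hx3.2 hx2.2.le⟩
    ⟨hy1, max_le hy3.1 hy2.1.le, le_min hy3.2 hy2.2.le⟩ ?_
  simp only [g, hc, Function.comp, hxy]

end SurfaceCurve

/-! ### Coordinates around a double point -/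

/-- The smooth inverse function theorem, with smoothness on the whole source and target. -/
theorem ContDiffOn.exists_openPartialHomeomorph {E F : Type*} [NormedAddCommGroup E]
    [NormedSpace ℝ E] [CompleteSpace E] [NormedAddCommGroup F] [NormedSpace ℝ F] {f : E → F}
    {W : Set E} (hf : ContDiffOn ℝ ∞ f W) (hW : IsOpen W) {a : E} (ha : a ∈ W) {f' : E ≃L[ℝ] F}
    (hf' : HasFDerivAt f (f' : E →L[ℝ] F) a) :
    ∃ Φ : OpenPartialHomeomorph E F, a ∈ Φ.source ∧ Φ.source ⊆ W ∧ (Φ : E → F) = f ∧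
      ContDiffOn ℝ ∞ Φ.symm Φ.target := by
  have hfa : ContDiffAt ℝ ∞ f a := hf.contDiffAt (hW.mem_nhds ha)
  let Φ₀ := hfa.toOpenPartialHomeomorph f hf' (by simp)
  have hcont : ContinuousOn (fderiv ℝ f) W :=
    hf.continuousOn_fderiv_of_isOpen hW (by simp)
  -- Restricting to the open set where the derivative is invertible makes the inverse smooth on the
  -- whole target, not only at the image of $a$.
  let V : Set E := W ∩ fderiv ℝ f ⁻¹' range ((↑) : (E ≃L[ℝ] F) → E →L[ℝ] F)
  have hV : IsOpen V := hcont.isOpen_inter_preimage hW ContinuousLinearEquiv.isOpen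
  refine ⟨Φ₀.restrOpen V hV, ?_, ?_, rfl, ?_⟩
  · rw [OpenPartialHomeomorph.restrOpen_source]
    exact ⟨hfa.mem_toOpenPartialHomeomorph_source hf' (by simp), ha, f', hf'.fderiv.symm⟩
  · rw [OpenPartialHomeomorph.restrOpen_source]
    exact fun x hx => hx.2.1
  · intro y hy
    have hx := (Φ₀.restrOpen V hV).map_target hy
    rw [OpenPartialHomeomorph.restrOpen_source] at hx
    obtain ⟨g, hg⟩ := hx.2.2
    have hfx : ContDiffAt ℝ ∞ f ((Φ₀.restrOpen V hV).symm y) :=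
      hf.contDiffAt (hW.mem_nhds hx.2.1)
    refine ((Φ₀.restrOpen V hV).contDiffAt_symm (f₀' := g) hy ?_ hfx).contDiffWithinAt
    rw [hg]
    exact (hfx.differentiableAt (by simp)).hasFDerivAt

/-- A model with corners, as a homeomorphism onto the interior of its range. -/
noncomputable def ModelWithCorners.interiorHomeomorph {E H : Type*} [NormedAddCommGroup E]
    [NormedSpace ℝ E] [TopologicalSpace H] (I : ModelWithCorners ℝ E H) :
    OpenPartialHomeomorph H E where
  toFun := I
  invFun := I.symm
  source := I ⁻¹' interior (range I)
  target := interior (range I)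
  map_source' _ hx := hx
  map_target' y hy := by
    rw [mem_preimage, I.right_inv (interior_subset hy)]; exact hy
  left_inv' x _ := I.left_inv x
  right_inv' y hy := I.right_inv (interior_subset hy)
  open_source := isOpen_interior.preimage I.continuous
  open_target := isOpen_interior
  continuousOn_toFun := I.continuous.continuousOn
  continuousOn_invFun := I.continuous_symm.continuousOn

/-- The linear equivalence `(x, y) ↦ x • v + y • w`. -/
theorem exists_continuousLinearEquiv_of_linearIndependent {v w : EuclideanSpace ℝ (Fin 2)}
    (h : LinearIndependent ℝ ![v, w]) :
    ∃ L : (ℝ × ℝ) ≃L[ℝ] EuclideanSpace ℝ (Fin 2), (L : (ℝ × ℝ) →L[ℝ] EuclideanSpace ℝ (Fin 2)) =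
      (ContinuousLinearMap.fst ℝ ℝ ℝ).smulRight v + (ContinuousLinearMap.snd ℝ ℝ ℝ).smulRight w := by
  set L₀ : (ℝ × ℝ) →L[ℝ] EuclideanSpace ℝ (Fin 2) :=
    (ContinuousLinearMap.fst ℝ ℝ ℝ).smulRight v + (ContinuousLinearMap.snd ℝ ℝ ℝ).smulRight w
  have hinj : Function.Injective (L₀ : (ℝ × ℝ) →ₗ[ℝ] EuclideanSpace ℝ (Fin 2)) := by
    rw [← LinearMap.ker_eq_bot, LinearMap.ker_eq_bot']
    rintro ⟨x, y⟩ hxy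
    have := LinearIndependent.pair_iff.1 h x y (by simpa [L₀] using hxy)
    simp [this]
  refine ⟨(LinearMap.linearEquivOfInjective (L₀ : (ℝ × ℝ) →ₗ[ℝ] EuclideanSpace ℝ (Fin 2)) hinj
    (by simp)).toContinuousLinearEquiv, ?_⟩
  ext x <;> simp

namespace SurfaceCurve

variable {S : Type*} [TopologicalSpace S] [ChartedSpace (EuclideanHalfSpace 2) S]
  [IsManifold (𝓡∂ 2) ∞ S] {γ : SurfaceCurve S}

theorem isPositivePair_velocity_swap_iff (o : SurfaceOrientation S) {p : S}
    (hp : p ∈ γ.doublePoints) :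
    IsPositivePair (o.at' p) (pathVelocity γ.toFun (γ.lastTime p))
        (pathVelocity γ.toFun (γ.firstTime p)) ↔
      ¬ IsPositivePair (o.at' p) (pathVelocity γ.toFun (γ.firstTime p))
        (pathVelocity γ.toFun (γ.lastTime p)) :=
  isPositivePair_swap_iff (V := TangentSpace (𝓡∂ 2) p) finrank_euclideanSpace_fin (o.at' p)
    (linearIndependent_velocity hp)

variable [T2Space S]

/-- Coordinates around a double point in which the curve, run through near its two times, is given
by `s ↦ (s, lastTime)` and `s ↦ (firstTime, s)`. -/
theorem exists_time_coordinates {p : S} (hp : p ∈ γ.doublePoints) {U : Set S} (hU : IsOpen U)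
    (hpU : p ∈ U) :
    ∃ φ : OpenPartialHomeomorph S (ℝ × ℝ), p ∈ φ.source ∧
      φ p = (γ.firstTime p, γ.lastTime p) ∧ φ.source ⊆ U ∧ φ.source ⊆ (𝓡∂ 2).interior S ∧
      ContMDiffOn (𝓡∂ 2) 𝓘(ℝ, ℝ × ℝ) ∞ φ φ.source ∧
      ContMDiffOn 𝓘(ℝ, ℝ × ℝ) (𝓡∂ 2) ∞ φ.symm φ.target ∧
      (∀ q ∈ φ.source, q ∈ γ.toFun '' Icc (0 : ℝ) 1 ↔
        (φ q).1 = γ.firstTime p ∨ (φ q).2 = γ.lastTime p) ∧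
      (∀ᶠ s in 𝓝 (γ.firstTime p), φ (γ.toFun s) = (s, γ.lastTime p)) ∧
      (∀ᶠ s in 𝓝 (γ.lastTime p), φ (γ.toFun s) = (γ.firstTime p, s)) := by
  set t := γ.firstTime p with ht_def
  set u := γ.lastTime p with hu_def
  have ht : t ∈ Ioo (0 : ℝ) 1 := firstTime_mem_Ioo hp
  have hu : u ∈ Ioo (0 : ℝ) 1 := lastTime_mem_Ioo hp
  have htp : γ.toFun t = p := apply_firstTime hp
  have hup : γ.toFun u = p := apply_lastTime hp
  set κ := chartAt (EuclideanHalfSpace 2) p with hκ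
  set c : ℝ → EuclideanSpace ℝ (Fin 2) := extChartAt (𝓡∂ 2) p ∘ γ.toFun with hc
  have hγo : ContinuousOn γ.toFun (Ioo (0 : ℝ) 1) := γ.continuousOn.mono Ioo_subset_Icc_self
  let O : Set ℝ := Ioo (0 : ℝ) 1 ∩ γ.toFun ⁻¹' κ.source
  have hO : IsOpen O := hγo.isOpen_inter_preimage isOpen_Ioo κ.open_source
  have htO : t ∈ O := ⟨ht, by rw [mem_preimage, htp]; exact mem_chart_source _ p⟩
  have huO : u ∈ O := ⟨hu, by rw [mem_preimage, hup]; exact mem_chart_source _ p⟩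
  have hcO : ContDiffOn ℝ ∞ c O := fun s hs =>
    (contDiffWithinAt_extChartAt (Ioo_subset_Icc_self hs.1) hs.2).mono
      (fun x hx => Ioo_subset_Icc_self hx.1)
  -- Since $c(u)=c(t)$, this map sends $(s,u)$ and $(t,s)$ both to $c(s)$: it straightens both
  -- branches at once. Its derivative at $(t,u)$ is $(x,y)\mapsto x\,c'(t)+y\,c'(u)$, invertible by
  -- transversality.
  let f : ℝ × ℝ → EuclideanSpace ℝ (Fin 2) := fun z => c z.1 + c z.2 - c t
  have hct : c t = extChartAt (𝓡∂ 2) p p := by simp [hc, htp]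
  have hcu : c u = c t := by simp [hc, htp, hup]
  have hfW : ContDiffOn ℝ ∞ f (O ×ˢ O) :=
    ((hcO.comp contDiffOn_fst (fun z hz => hz.1)).add
      (hcO.comp contDiffOn_snd (fun z hz => hz.2))).sub contDiffOn_const
  have hdt : HasDerivAt c (pathVelocity γ.toFun t) t := by
    have := hasDerivWithinAt_extChartAt (γ := γ) (Ioo_subset_Icc_self ht)
    rw [htp] at this
    exact this.hasDerivAt (Icc_mem_nhds ht.1 ht.2)
  have hdu : HasDerivAt c (pathVelocity γ.toFun u) u := by
    have := hasDerivWithinAt_extChartAt (γ := γ) (Ioo_subset_Icc_self hu)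
    rw [hup] at this
    exact this.hasDerivAt (Icc_mem_nhds hu.1 hu.2)
  obtain ⟨L, hL⟩ := exists_continuousLinearEquiv_of_linearIndependent
    (linearIndependent_velocity hp)
  have hf' : HasFDerivAt f (L : (ℝ × ℝ) →L[ℝ] EuclideanSpace ℝ (Fin 2)) (t, u) := by
    have h1 : HasFDerivAt (fun z : ℝ × ℝ => c z.1) _ (t, u) :=
      HasFDerivAt.comp (t, u) (f := Prod.fst) hdt.hasFDerivAt hasFDerivAt_fst
    have h2 : HasFDerivAt (fun z : ℝ × ℝ => c z.2) _ (t, u) :=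
      HasFDerivAt.comp (t, u) (f := Prod.snd) hdu.hasFDerivAt hasFDerivAt_snd
    refine ((h1.add h2).sub_const (c t)).congr_fderiv ?_
    rw [hL]
    ext <;> simp [ht_def, hu_def]
  obtain ⟨Φ, hΦa, hΦW, hΦf, hΦs⟩ :=
    hfW.exists_openPartialHomeomorph (hO.prod hO) (a := (t, u)) ⟨htO, huO⟩ hf'
  -- The double point is interior, so the extended chart restricts to an open partial homeomorphism
  -- into the plane around it.
  let ψ : OpenPartialHomeomorph S (EuclideanSpace ℝ (Fin 2)) :=
    κ.trans (𝓡∂ 2).interiorHomeomorph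
  have hψ : ∀ x, ψ x = extChartAt (𝓡∂ 2) p x := fun _ => rfl
  have hψsrc : ψ.source ⊆ κ.source := fun x hx => hx.1
  have hpψ : p ∈ ψ.source := by
    refine ⟨mem_chart_source _ p, ?_⟩
    exact mem_interior_of_mem_doublePoints hp
  have hftu : f (t, u) = ψ p := by simp [f, hcu, hct, hψ]
  let φ₀ := ψ.trans Φ.symm
  have hφ₀p : φ₀ p = (t, u) := by
    change Φ.symm (ψ p) = (t, u)
    rw [← hftu, ← hΦf, Φ.left_inv hΦa]
  have hpφ₀ : p ∈ φ₀.source := by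
    rw [OpenPartialHomeomorph.trans_source]
    refine ⟨hpψ, ?_⟩
    rw [mem_preimage, ← hftu, ← hΦf]
    exact Φ.map_source hΦa
  obtain ⟨δ, hδ, hball⟩ := Metric.isOpen_iff.1 Φ.open_source _ hΦa
  -- The rest of the curve is compact and misses $p$. Removing it from the source leaves only points
  -- of the curve with times near $t$ or $u$.
  let Z : Set S := γ.toFun '' (Icc (0 : ℝ) 1 \ (Metric.ball t δ ∪ Metric.ball u δ))
  have hZ : IsClosed Z := by
    refine (IsCompact.image_of_continuousOn ?_ (γ.continuousOn.mono sdiff_subset)).isClosed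
    exact isCompact_Icc.diff (Metric.isOpen_ball.union Metric.isOpen_ball)
  have hpZ : p ∉ Z := by
    rintro ⟨s, ⟨hs, hs'⟩, hsp⟩
    rcases eq_firstTime_or_lastTime hp hs hsp with h | h
    · exact hs' (Or.inl (by rw [h]; exact Metric.mem_ball_self hδ))
    · exact hs' (Or.inr (by rw [h]; exact Metric.mem_ball_self hδ))
  let N : Set S := (U ∩ (𝓡∂ 2).interior S ∩ Zᶜ) ∩ (φ₀.source ∩ φ₀ ⁻¹' Metric.ball (t, u) δ)
  have hN : IsOpen N := by
    refine ((hU.inter ((𝓡∂ 2).isOpen_interior (n := ∞) (by simp))).inter hZ.isOpen_compl).inter ?_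
    exact φ₀.isOpen_inter_preimage Metric.isOpen_ball
  have hpN : p ∈ N := ⟨⟨⟨hpU, mem_interior_of_mem_doublePoints hp⟩, hpZ⟩, hpφ₀, by
    rw [mem_preimage, hφ₀p]; exact Metric.mem_ball_self hδ⟩
  let φ := φ₀.restrOpen N hN
  have hφsrc : φ.source = N := by
    rw [OpenPartialHomeomorph.restrOpen_source]
    exact inter_eq_right.2 fun x hx => hx.2.1
  have hφa : ∀ q, φ q = Φ.symm (ψ q) := fun _ => rfl
  have hfst : ∀ s ∈ Metric.ball t δ, (s, u) ∈ Φ.source := fun s hs => hball (by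
    rw [← ball_prod_same]; exact ⟨hs, Metric.mem_ball_self hδ⟩)
  have hsnd : ∀ s ∈ Metric.ball u δ, (t, s) ∈ Φ.source := fun s hs => hball (by
    rw [← ball_prod_same]; exact ⟨Metric.mem_ball_self hδ, hs⟩)
  have hφt : ∀ s ∈ Metric.ball t δ, φ (γ.toFun s) = (s, u) := by
    intro s hs
    rw [hφa]
    have : ψ (γ.toFun s) = Φ (s, u) := by
      rw [hΦf]; simp only [f, hcu]; simp [hψ, hc]
    rw [this, Φ.left_inv (hfst s hs)]
  have hφu : ∀ s ∈ Metric.ball u δ, φ (γ.toFun s) = (t, s) := by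
    intro s hs
    rw [hφa]
    have : ψ (γ.toFun s) = Φ (t, s) := by
      rw [hΦf]; simp [f, hψ, hc]
    rw [this, Φ.left_inv (hsnd s hs)]
  refine ⟨φ, ?_, hφ₀p, ?_, ?_, ?_, ?_, ?_, ?_, ?_⟩
  · rw [hφsrc]; exact hpN
  · rw [hφsrc]; exact fun x hx => hx.1.1.1
  · rw [hφsrc]; exact fun x hx => hx.1.1.2
  · have h1 : ContMDiffOn (𝓡∂ 2) 𝓘(ℝ, EuclideanSpace ℝ (Fin 2)) ∞ ψ φ.source :=
      (contMDiffOn_extChartAt (I := 𝓡∂ 2) (n := ∞) (x := p)).mono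
        (fun x hx => hψsrc (by rw [hφsrc] at hx; exact hx.2.1.1))
    exact (contMDiffOn_iff_contDiffOn.2 hΦs).comp h1
      (fun x hx => by rw [hφsrc] at hx; exact hx.2.1.2)
  · have h1 : ContMDiffOn 𝓘(ℝ, ℝ × ℝ) 𝓘(ℝ, EuclideanSpace ℝ (Fin 2)) ∞ Φ φ.target := by
      rw [contMDiffOn_iff_contDiffOn, hΦf]
      exact hfW.mono (fun x hx => hΦW hx.1.1)
    refine (contMDiffOn_extChartAt_symm (I := 𝓡∂ 2) (n := ∞) p).comp h1 (fun x hx => ?_)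
    have hx' : Φ x ∈ ψ.target := hx.1.2
    have h2 := hψsrc (ψ.map_target hx')
    change Φ x ∈ (extChartAt (𝓡∂ 2) p).target
    rw [← ψ.right_inv hx', hψ]
    exact (extChartAt (𝓡∂ 2) p).map_source (by rw [extChartAt_source]; exact h2)
  · intro q hq
    rw [hφsrc] at hq
    constructor
    · rintro ⟨s, hs, rfl⟩
      have : s ∈ Metric.ball t δ ∪ Metric.ball u δ := by
        by_contra h
        exact hq.1.2 ⟨s, ⟨hs, h⟩, rfl⟩
      rcases this with h | h
      · right; rw [hφt s h]
      · left; rw [hφu s h]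
    -- Conversely, a point on one of the two coordinate lines has the same chart image as the curve
    -- at the time given by its other coordinate, and the chart is injective.
    · have hqψ : q ∈ ψ.source := hq.2.1.1
      have hqΦ : Φ (φ q) = ψ q := Φ.right_inv hq.2.1.2
      have hqball : φ q ∈ Metric.ball (t, u) δ := hq.2.2
      rw [← ball_prod_same] at hqball
      have hinj := (extChartAt (𝓡∂ 2) p).injOn
      rw [extChartAt_source] at hinj
      rintro (h | h)
      · have hm := (hΦW (hsnd _ hqball.2)).2
        refine ⟨(φ q).2, Ioo_subset_Icc_self hm.1, ?_⟩
        refine hinj hm.2 (hψsrc hqψ) ?_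
        rw [← hψ q, ← hqΦ, hΦf]
        simp [f, h, hc]
      · have hm := (hΦW (hfst _ hqball.1)).1
        refine ⟨(φ q).1, Ioo_subset_Icc_self hm.1, ?_⟩
        refine hinj hm.2 (hψsrc hqψ) ?_
        rw [← hψ q, ← hqΦ, hΦf]
        simp only [f, h, hcu]
        simp [hc]
  · filter_upwards [Metric.ball_mem_nhds t hδ] with s hs using hφt s hs
  · filter_upwards [Metric.ball_mem_nhds u hδ] with s hs using hφu s hs

/-- The affine homeomorphism `(x, y) ↦ (r (x - t), σ r (y - u))` of the plane. -/
noncomputable def axisScaling (t u r σ : ℝ) (hr : r ≠ 0) (hσ : σ ≠ 0) : ℝ × ℝ ≃ₜ ℝ × ℝ where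
  toFun z := (r * (z.1 - t), σ * r * (z.2 - u))
  invFun z := (r⁻¹ * z.1 + t, (σ * r)⁻¹ * z.2 + u)
  left_inv z := by ext <;> simp <;> field_simp <;> ring
  right_inv z := by ext <;> simp <;> field_simp
  continuous_toFun := by fun_prop
  continuous_invFun := by fun_prop

/-- Around every double point there are crossing charts with arbitrarily small source. -/
theorem exists_isCrossingChart (o : SurfaceOrientation S) {p : S} (hp : p ∈ γ.doublePoints)
    {U : Set S} (hU : IsOpen U) (hpU : p ∈ U) :
    ∃ φ : OpenPartialHomeomorph S (ℝ × ℝ), γ.diagram.IsCrossingChart o p φ ∧ φ.source ⊆ U := by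
  obtain ⟨φ, hpφ, hφp, hφU, hφi, hφs, hφs', hφc, hφt, hφu⟩ := exists_time_coordinates hp hU hpU
  set t := γ.firstTime p with ht_def
  set u := γ.lastTime p with hu_def
  have htp : γ.toFun t = p := apply_firstTime hp
  have hup : γ.toFun u = p := apply_lastTime hp
  have htar : (t, u) ∈ φ.target := hφp ▸ φ.map_source hpφ
  obtain ⟨ε, hε, hball⟩ := Metric.isOpen_iff.1 φ.open_target _ htar
  -- With this scale the model square corresponds to the box of half-width $\varepsilon/2$ around
  -- $(t,u)$, inside the ball on which the inverse coordinates are defined.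
  let r : ℝ := 2 / ε
  have hr : 0 < r := by positivity
  -- At a negative crossing the second axis is reversed, so that the coordinates are positively
  -- oriented. One positive pair suffices to check this.
  obtain ⟨σ, hσ, hσpos⟩ : ∃ σ : ℝ, |σ| = 1 ∧
      ∀ L : EuclideanSpace ℝ (Fin 2) →ₗ[ℝ] ℝ × ℝ, L (pathVelocity γ.toFun t) = (r, 0) →
        L (pathVelocity γ.toFun u) = (0, σ * r) → ∀ v w : EuclideanSpace ℝ (Fin 2),
        IsPositivePair (o.at' p) v w → 0 < planeDet L v w := by
    by_cases h : IsPositivePair (o.at' p) (pathVelocity γ.toFun t) (pathVelocity γ.toFun u)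
    · refine ⟨1, by simp, fun L h1 h2 v w hvw => h.planeDet_pos hvw L ?_⟩
      simp only [planeDet]
      erw [h1, h2]
      simpa using mul_pos hr hr
    · have h' := (isPositivePair_velocity_swap_iff o hp).2 h
      refine ⟨-1, by simp, fun L h1 h2 v w hvw => h'.planeDet_pos hvw L ?_⟩
      simp only [planeDet]
      erw [h1, h2]
      simpa using mul_pos hr hr
  have hσ0 : σ ≠ 0 := by rintro rfl; simp at hσ
  let A := axisScaling t u r σ hr.ne' hσ0
  have hA : ∀ z, A z = (r * (z.1 - t), σ * r * (z.2 - u)) := fun _ => rfl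
  have hA' : ∀ z, A.symm z = (r⁻¹ * z.1 + t, (σ * r)⁻¹ * z.2 + u) := fun _ => rfl
  have hAs : ContDiff ℝ ∞ A := by
    change ContDiff ℝ ∞ fun z : ℝ × ℝ => (r * (z.1 - t), σ * r * (z.2 - u))
    fun_prop
  have hAs' : ContDiff ℝ ∞ A.symm := by
    change ContDiff ℝ ∞ fun z : ℝ × ℝ => (r⁻¹ * z.1 + t, (σ * r)⁻¹ * z.2 + u)
    fun_prop
  let φ' := φ.transHomeomorph A
  have hφ' : ∀ q, φ' q = A (φ q) := fun _ => rfl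
  have hsm : ContMDiffOn (𝓡∂ 2) 𝓘(ℝ, ℝ × ℝ) ∞ φ' φ'.source :=
    hAs.contMDiff.comp_contMDiffOn hφs
  have hmd : MDifferentiableAt (𝓡∂ 2) 𝓘(ℝ, ℝ × ℝ) φ' p :=
    ((hsm p hpφ).mdifferentiableWithinAt (by simp)).mdifferentiableAt
      (φ'.open_source.mem_nhds hpφ)
  have hLt : mfderiv (𝓡∂ 2) 𝓘(ℝ, ℝ × ℝ) φ' p (pathVelocity γ.toFun t) = (r, (0 : ℝ)) := by
    have h1 := hasDerivAt_comp (γ := γ) (φ := φ') (firstTime_mem_Ioo hp) (by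
      rw [apply_firstTime hp]; exact hmd)
    rw [apply_firstTime hp] at h1
    have h2 : HasDerivAt (fun s => ((r * (s - t), 0) : ℝ × ℝ)) (r, 0) t := by
      refine HasDerivAt.prodMk ?_ (hasDerivAt_const _ _)
      simpa using ((hasDerivAt_id t).sub_const t).const_mul r
    refine h1.unique (h2.congr_of_eventuallyEq ?_)
    filter_upwards [hφt] with s hs
    simp [hφ', hA, hs]
  have hLu : mfderiv (𝓡∂ 2) 𝓘(ℝ, ℝ × ℝ) φ' p (pathVelocity γ.toFun u) = ((0 : ℝ), σ * r) := by
    have h1 := hasDerivAt_comp (γ := γ) (φ := φ') (lastTime_mem_Ioo hp) (by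
      rw [apply_lastTime hp]; exact hmd)
    rw [apply_lastTime hp] at h1
    have h2 : HasDerivAt (fun s => ((0, σ * r * (s - u)) : ℝ × ℝ)) (0, σ * r) u := by
      refine HasDerivAt.prodMk (hasDerivAt_const _ _) ?_
      simpa using ((hasDerivAt_id u).sub_const u).const_mul (σ * r)
    refine h1.unique (h2.congr_of_eventuallyEq ?_)
    filter_upwards [hφu] with s hs
    simp [hφ', hA, hs]
  refine ⟨φ', ⟨hpφ, ?_, hφi, ?_, hsm, ?_, ?_, ?_, ?_, ?_⟩, hφU⟩
  · rw [hφ', hφp, hA]; simp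
  · rintro ⟨x, y⟩ ⟨hx, hy⟩
    change A.symm (x, y) ∈ φ.target
    refine hball ?_
    rw [← ball_prod_same, hA']
    have hb : ∀ z ∈ Icc (-1 : ℝ) 1, |r⁻¹ * z| < ε := by
      intro z hz
      rw [abs_mul, abs_of_pos (inv_pos.2 hr)]
      have : |z| ≤ 1 := abs_le.2 hz
      calc r⁻¹ * |z| ≤ r⁻¹ * 1 := by gcongr
        _ = ε / 2 := by simp [r]
        _ < ε := by linarith
    refine ⟨?_, ?_⟩
    · simpa [Real.dist_eq] using hb x hx
    · have := hb y hy
      rw [Metric.mem_ball, Real.dist_eq, add_sub_cancel_right, mul_inv, mul_assoc, abs_mul, abs_inv,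
        hσ]
      simpa using this
  · exact hφs'.comp hAs'.contMDiff.contMDiffOn (fun z hz => hz)
  · intro q hq
    have := hφc q hq
    rw [hφ', hA]
    simp only [mul_eq_zero, hr.ne', hσ0, sub_eq_zero, false_or]
    exact this
  · change (mfderiv (𝓡∂ 2) 𝓘(ℝ, ℝ × ℝ) φ' p (pathVelocity γ.toFun t) : ℝ × ℝ).2 = 0
    rw [hLt]
  · change (mfderiv (𝓡∂ 2) 𝓘(ℝ, ℝ × ℝ) φ' p (pathVelocity γ.toFun u) : ℝ × ℝ).1 = 0
    rw [hLu]
  · intro v w hvw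
    exact hσpos (mfderiv (𝓡∂ 2) 𝓘(ℝ, ℝ × ℝ) φ' p).toLinearMap hLt hLu v w hvw

/-- The curve has finitely many double points. -/
theorem finite_doublePoints : γ.doublePoints.Finite := by
  let P : Set (ℝ × ℝ) := {z | z.1 ∈ Icc (0 : ℝ) 1 ∧ z.2 ∈ Icc (0 : ℝ) 1 ∧ z.1 < z.2 ∧
    γ.toFun z.1 = γ.toFun z.2}
  have hP : P.Finite := by
    by_contra hinf
    -- Infinitely many pairs of double times would accumulate at some $(t,u)$. This is excluded by
    -- local injectivity if $t=u$, by the time coordinates if $t<u$ have the same image, by the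
    -- order of the pairs if $t>u$ do, and by Hausdorff separation otherwise.
    obtain ⟨⟨t, u⟩, ⟨ht, hu⟩, hacc⟩ := Set.Infinite.exists_accPt_of_subset_isCompact
      (K := Icc (0 : ℝ) 1 ×ˢ Icc (0 : ℝ) 1) hinf (isCompact_Icc.prod isCompact_Icc)
      (fun z hz => ⟨hz.1, hz.2.1⟩)
    simp only at ht hu
    rw [accPt_iff_frequently] at hacc
    refine hacc ?_
    rw [nhds_prod_eq]
    by_cases htu : t = u
    · subst htu
      obtain ⟨V, hV, hinj⟩ := γ.exists_injOn ht
      filter_upwards [prod_mem_prod hV hV] with z hz hz'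
      exact hz'.2.2.2.1.ne (hinj ⟨hz.1, hz'.2.1⟩ ⟨hz.2, hz'.2.2.1⟩ hz'.2.2.2.2)
    by_cases hγ : γ.toFun t = γ.toFun u
    · have hp : γ.toFun t ∈ γ.doublePoints := ⟨t, ht, u, hu, htu, rfl, hγ.symm⟩
      rcases lt_or_gt_of_ne htu with hlt | hlt
      · have htf : t = γ.firstTime (γ.toFun t) ∧ u = γ.lastTime (γ.toFun t) := by
          rcases eq_firstTime_or_lastTime hp ht rfl with h | h <;>
            rcases eq_firstTime_or_lastTime hp hu hγ.symm with h' | h'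
          · exact absurd (h.trans h'.symm) htu
          · exact ⟨h, h'⟩
          · have := (times_lt hp).2.1
            rw [← h, ← h'] at this
            exact absurd this hlt.not_gt
          · exact absurd (h.trans h'.symm) htu
        obtain ⟨φ, -, -, -, -, -, -, -, h1, h2⟩ := exists_time_coordinates hp isOpen_univ trivial
        rw [← htf.1, ← htf.2] at h1 h2
        filter_upwards [prod_mem_prod h1 h2] with z hz hz'
        have e1 : φ (γ.toFun z.1) = (z.1, u) := hz.1
        have e2 : φ (γ.toFun z.2) = (t, z.2) := hz.2
        -- Equal images give $(z_1,u)=(t,z_2)$, so the pair is the accumulation point itself.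
        rw [hz'.2.2.2.2, e2, Prod.mk.injEq] at e1
        exact hz'.1 (Prod.ext e1.1.symm e1.2)
      · obtain ⟨a, ha1, ha2⟩ := exists_between hlt
        filter_upwards [prod_mem_prod (Ioi_mem_nhds ha2) (Iio_mem_nhds ha1)] with z hz hz'
        exact (lt_trans hz.2 hz.1).not_gt hz'.2.2.2.1
    · obtain ⟨U, V, hU, hV, htU, huV, hUV⟩ := t2_separation hγ
      have h1 := eventually_nhdsWithin_iff.1 ((γ.continuousOn t ht).eventually (hU.mem_nhds htU))
      have h2 := eventually_nhdsWithin_iff.1 ((γ.continuousOn u hu).eventually (hV.mem_nhds huV))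
      filter_upwards [prod_mem_prod h1 h2] with z hz hz'
      have hzU : γ.toFun z.1 ∈ U := hz.1 hz'.2.1
      have hzV : γ.toFun z.2 ∈ V := hz.2 hz'.2.2.1
      rw [hz'.2.2.2.2] at hzU
      exact hUV.le_bot ⟨hzU, hzV⟩
  refine (hP.image fun z => γ.toFun z.1).subset ?_
  intro p hp
  refine ⟨(γ.firstTime p, γ.lastTime p), ⟨Ioo_subset_Icc_self (firstTime_mem_Ioo hp),
    Ioo_subset_Icc_self (lastTime_mem_Ioo hp), (times_lt hp).2.1, ?_⟩, apply_firstTime hp⟩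
  exact (apply_firstTime hp).trans (apply_lastTime hp).symm

end SurfaceCurve

/-! ### Existence of splittings -/

theorem isModelArc_segment {x y : ℝ × ℝ} (hx : x ∈ modelSquare) (hy : y ∈ modelSquare)
    (hxy : x ≠ y) : IsModelArc (segment ℝ x y) x y := by
  refine ⟨((convex_Icc _ _).prod (convex_Icc _ _)).segment_subset hx hy,
    AffineMap.lineMap x y, AffineMap.lineMap_continuous.continuousOn,
    (AffineMap.lineMap_injective ℝ hxy).injOn, by simp, by simp, ?_⟩
  rw [segment_eq_image_lineMap]

/-- Straight segments do: for type $A$ they lie on the lines $y-x=\pm1$, for type $B$ on $x+y=\pm1$.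
-/
theorem exists_isModelSplitting (σ : SplitType) : ∃ m, IsModelSplitting σ m := by
  have hW : ((-1, 0) : ℝ × ℝ) ∈ modelSquare := by simp [modelSquare]
  have hE : ((1, 0) : ℝ × ℝ) ∈ modelSquare := by simp [modelSquare]
  have hN : ((0, 1) : ℝ × ℝ) ∈ modelSquare := by simp [modelSquare]
  have hS : ((0, -1) : ℝ × ℝ) ∈ modelSquare := by simp [modelSquare]
  cases σ with
  | A =>
    refine ⟨_, _, _, isModelArc_segment hW hN (by simp), isModelArc_segment hS hE (by simp), ?_, rfl⟩
    rw [Set.disjoint_left]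
    rintro _ ⟨a, b, _, _, hab, rfl⟩ ⟨a', b', _, _, hab', h⟩
    simp only [Prod.smul_mk, Prod.mk_add_mk, Prod.mk.injEq, smul_eq_mul] at h
    linarith [h.1, h.2]
  | B =>
    refine ⟨_, _, _, isModelArc_segment hW hS (by simp), isModelArc_segment hN hE (by simp), ?_, rfl⟩
    rw [Set.disjoint_left]
    rintro _ ⟨a, b, _, _, hab, rfl⟩ ⟨a', b', _, _, hab', h⟩
    simp only [Prod.smul_mk, Prod.mk_add_mk, Prod.mk.injEq, smul_eq_mul] at h
    linarith [h.1, h.2]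

theorem IsModelSplitting.subset_modelSquare {σ : SplitType} {m : Set (ℝ × ℝ)}
    (h : IsModelSplitting σ m) : m ⊆ modelSquare := by
  cases σ <;> obtain ⟨a, b, ha, hb, -, rfl⟩ := h <;> exact union_subset ha.1 hb.1

theorem IsModelArc.isCompact {a : Set (ℝ × ℝ)} {x y : ℝ × ℝ} (h : IsModelArc a x y) :
    IsCompact a := by
  obtain ⟨-, f, hf, -, -, -, rfl⟩ := h
  exact isCompact_Icc.image_of_continuousOn hf

theorem IsModelArc.isConnected {a : Set (ℝ × ℝ)} {x y : ℝ × ℝ} (h : IsModelArc a x y) :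
    IsConnected a := by
  obtain ⟨-, f, hf, -, -, -, rfl⟩ := h
  exact (isConnected_Icc zero_le_one).image f hf

theorem IsModelArc.left_mem {a : Set (ℝ × ℝ)} {x y : ℝ × ℝ} (h : IsModelArc a x y) : x ∈ a := by
  obtain ⟨-, f, -, -, rfl, -, rfl⟩ := h
  exact mem_image_of_mem f (left_mem_Icc.2 zero_le_one)

theorem IsModelArc.right_mem {a : Set (ℝ × ℝ)} {x y : ℝ × ℝ} (h : IsModelArc a x y) : y ∈ a := by
  obtain ⟨-, f, -, -, -, rfl, rfl⟩ := h
  exact mem_image_of_mem f (right_mem_Icc.2 zero_le_one)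

namespace LinkDiagram

variable {S : Type*} [TopologicalSpace S]

theorem disc_subset_source {φ : OpenPartialHomeomorph S (ℝ × ℝ)} (h : modelSquare ⊆ φ.target) :
    disc φ ⊆ φ.source := by
  rintro _ ⟨z, hz, rfl⟩
  exact φ.map_target (h hz)

theorem mem_disc_iff {φ : OpenPartialHomeomorph S (ℝ × ℝ)} (h : modelSquare ⊆ φ.target) {q : S} :
    q ∈ disc φ ↔ q ∈ φ.source ∧ φ q ∈ modelSquare := by
  constructor
  · intro hq
    refine ⟨disc_subset_source h hq, ?_⟩
    obtain ⟨z, hz, rfl⟩ := hq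
    rwa [φ.right_inv (h hz)]
  · rintro ⟨h1, h2⟩
    exact ⟨φ q, h2, φ.left_inv h1⟩

end LinkDiagram

namespace SurfaceCurve

variable {S : Type*} [TopologicalSpace S] [ChartedSpace (EuclideanHalfSpace 2) S]
  [IsManifold (𝓡∂ 2) ∞ S] {γ : SurfaceCurve S} [T2Space S]

/-- Every state is realized by a splitting. -/
theorem exists_isSplitting (o : SurfaceOrientation S) (s : γ.diagram.State) :
    ∃ E : Set S, γ.diagram.IsSplitting o s E := by
  -- Finitely many points have pairwise disjoint neighbourhoods, and crossing charts can be taken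
  -- inside them.
  obtain ⟨U, hU, hdisj⟩ := (finite_doublePoints (γ := γ)).t2_separation
  choose φ hφ hφU using fun p : γ.diagram.crossings =>
    exists_isCrossingChart o (γ := γ) p.2 (hU p).2 (hU p).1
  choose m hm using fun p => exists_isModelSplitting (s p)
  have hsub : ∀ p, (φ p).symm '' m p ⊆ LinkDiagram.disc (φ p) := fun p =>
    image_mono (hm p).subset_modelSquare
  have hd : ∀ p q : γ.diagram.crossings, p ≠ q →
      Disjoint (LinkDiagram.disc (φ p)) (LinkDiagram.disc (φ q)) := by
    intro p q hpq
    refine (hdisj p.2 q.2 (Subtype.coe_injective.ne hpq)).mono ?_ ?_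
    · exact (LinkDiagram.disc_subset_source (hφ p).square_subset).trans (hφU p)
    · exact (LinkDiagram.disc_subset_source (hφ q).square_subset).trans (hφU q)
  refine ⟨{x | (x ∈ γ.diagram.carrier ∧ ∀ p, x ∉ LinkDiagram.disc (φ p)) ∨
    ∃ p, x ∈ (φ p).symm '' m p}, φ, hφ, hd, ?_, fun p => ⟨m p, hm p, ?_⟩⟩
  · intro x hx
    constructor
    · rintro (h | ⟨p, h⟩)
      · exact h.1
      · exact absurd (hsub p h) (hx p)
    · exact fun h => Or.inl ⟨h, hx⟩
  · ext x
    constructor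
    · rintro ⟨h | ⟨q, h⟩, hx⟩
      · exact absurd hx (h.2 p)
      · by_cases hqp : q = p
        · exact hqp ▸ h
        · exact absurd hx (Set.disjoint_left.1 (hd q p hqp) (hsub q h))
    · exact fun h => ⟨Or.inr ⟨p, h⟩, hsub p h⟩

end SurfaceCurve

/-! ### The curve in a crossing chart -/

namespace SurfaceCurve

variable {S : Type*} [TopologicalSpace S] [ChartedSpace (EuclideanHalfSpace 2) S]
  {γ : SurfaceCurve S}

open LinkDiagram (disc disc_subset_source mem_disc_iff)

theorem zero_mem_modelSquare : (0 : ℝ × ℝ) ∈ modelSquare := ⟨by simp, by simp⟩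

/-- The two times at which the curve runs through a double point. -/
noncomputable def time (γ : SurfaceCurve S) (p : S) : Bool → ℝ
  | false => γ.firstTime p
  | true => γ.lastTime p

/-- The double point `p` is positive if the tangent vectors of the curve, in the order in which it
passes through `p`, form a positive basis. -/
def IsPositive [IsManifold (𝓡∂ 2) ∞ S] (o : SurfaceOrientation S) (γ : SurfaceCurve S) (p : S) :
    Prop :=
  IsPositivePair (o.at' p) (pathVelocity γ.toFun (γ.firstTime p))
    (pathVelocity γ.toFun (γ.lastTime p))

/-- A splitting of type `σ` at the double point `p` joins an incoming and an outgoing strand. -/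
def IsCoherent [IsManifold (𝓡∂ 2) ∞ S] (o : SurfaceOrientation S) (γ : SurfaceCurve S) (p : S)
    (σ : SplitType) : Prop :=
  (σ = SplitType.A ∧ γ.IsPositive o p) ∨ (σ = SplitType.B ∧ ¬ γ.IsPositive o p)

/-- `l b ≤ r b` are the times at which the curve enters and leaves the closed disc `Δ` around `p`
when it passes through `p` for the first (`b = false`) or second (`b = true`) time, and the sets
`arc false`, `arc true` are disjoint arcs that join the four points of entry and exit. -/
structure IsLocalSplitting (γ : SurfaceCurve S) (p : S) (Δ m : Set S) (coherent : Prop)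
    (l r : Bool → ℝ) (arc : Bool → Set S) : Prop where
  left_lt : ∀ b, l b < γ.time p b
  lt_right : ∀ b, γ.time p b < r b
  preimage_eq : Icc (0 : ℝ) 1 ∩ γ.toFun ⁻¹' Δ = Icc (l false) (r false) ∪ Icc (l true) (r true)
  disjoint : Disjoint (Icc (l false) (r false)) (Icc (l true) (r true))
  isCompact_arc : ∀ e, IsCompact (arc e)
  isConnected_arc : ∀ e, IsConnected (arc e)
  disjoint_arc : Disjoint (arc false) (arc true)
  union_arc : arc false ∪ arc true = m
  left_false : γ.toFun (l false) ∈ arc false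
  right_false : γ.toFun (r false) ∈ arc true
  of_coherent : coherent → γ.toFun (l true) ∈ arc true ∧ γ.toFun (r true) ∈ arc false
  of_not_coherent : ¬ coherent → γ.toFun (l true) ∈ arc false ∧ γ.toFun (r true) ∈ arc true

/-- In coordinates in which the curve is the union of the two axes, the times different from `u` at
which it runs through the horizontal segment of the model square form an interval around `t`. -/
theorem exists_horizontal_interval [T2Space S] {φ : OpenPartialHomeomorph S (ℝ × ℝ)} {p : S}
    (hpφ : p ∈ φ.source) (hφp : φ p = 0)
    (hsq : modelSquare ⊆ φ.target)
    (hcar : ∀ q ∈ φ.source, q ∈ γ.toFun '' Icc (0 : ℝ) 1 ↔ (φ q).1 = 0 ∨ (φ q).2 = 0)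
    (hdisc : ∀ q ∈ γ.doublePoints, q ∈ disc φ → q = p)
    {t u : ℝ} (ht : t ∈ Ioo (0 : ℝ) 1) (htu : t ≠ u) (htp : γ.toFun t = p)
    (hup : γ.toFun u = p)
    (hp : ∀ s ∈ Icc (0 : ℝ) 1, γ.toFun s = p → s = t ∨ s = u)
    {κ κ' : ℝ} (hdt : HasDerivAt (φ ∘ γ.toFun) (κ, 0) t)
    (hdu : HasDerivAt (φ ∘ γ.toFun) (0, κ') u) (hκ' : κ' ≠ 0) :
    ∃ l r : ℝ, l < t ∧ t < r ∧
      {s ∈ Icc (0 : ℝ) 1 | s ≠ u ∧ γ.toFun s ∈ disc φ ∧ (φ (γ.toFun s)).2 = 0} = Icc l r ∧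
      (0 < κ → (φ (γ.toFun l)).1 = -1 ∧ (φ (γ.toFun r)).1 = 1) ∧
      (κ < 0 → (φ (γ.toFun l)).1 = 1 ∧ (φ (γ.toFun r)).1 = -1) := by
  set J : Set ℝ := {s ∈ Icc (0 : ℝ) 1 | s ≠ u ∧ γ.toFun s ∈ disc φ ∧ (φ (γ.toFun s)).2 = 0}
    with hJ
  let H : Set S := φ.symm '' (Icc (-1 : ℝ) 1 ×ˢ {0})
  have hHsq : (Icc (-1 : ℝ) 1 ×ˢ {0} : Set (ℝ × ℝ)) ⊆ modelSquare := by
    rintro ⟨x, y⟩ ⟨hx, hy⟩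
    refine ⟨hx, ?_⟩
    rw [show y = 0 from hy]; simp
  have hHmem : ∀ q, q ∈ H ↔ q ∈ disc φ ∧ (φ q).2 = 0 := by
    intro q
    constructor
    · rintro ⟨z, hz, rfl⟩
      refine ⟨⟨z, hHsq hz, rfl⟩, ?_⟩
      rw [φ.right_inv (hsq (hHsq hz))]; exact hz.2
    · rintro ⟨⟨z, hz, rfl⟩, h⟩
      rw [φ.right_inv (hsq hz)] at h
      exact ⟨z, ⟨hz.1, h⟩, rfl⟩
  have hHc : IsClosed H := by
    refine ((isCompact_Icc.prod isCompact_singleton).image_of_continuousOn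
      (φ.continuousOn_symm.mono (hHsq.trans hsq))).isClosed
  -- The other strand also meets the horizontal axis, at time $u$, but crosses it with nonzero
  -- speed. So $u$ is isolated among the times on that axis, and $J$ stays compact when it is
  -- removed.
  have hiso : ∀ᶠ s in 𝓝[≠] u, (φ (γ.toFun s)).2 ≠ 0 := by
    have : HasDerivAt (fun s => ((φ ∘ γ.toFun) s).2) κ' u := hdu.snd
    exact this.eventually_ne hκ'
  obtain ⟨δ, hδ, hball⟩ := Metric.mem_nhdsWithin_iff.1 hiso
  have hJeq : J = (Icc (0 : ℝ) 1 ∩ γ.toFun ⁻¹' H) \ Metric.ball u δ := by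
    ext s
    constructor
    · rintro ⟨hs, hsu, hsd, hs0⟩
      exact ⟨⟨hs, (hHmem _).2 ⟨hsd, hs0⟩⟩, fun hb => hball ⟨hb, hsu⟩ hs0⟩
    · rintro ⟨⟨hs, hsH⟩, hb⟩
      refine ⟨hs, ?_, (hHmem _).1 hsH⟩
      rintro rfl
      exact hb (Metric.mem_ball_self hδ)
  have hJc : IsCompact J := by
    rw [hJeq]
    exact (isCompact_Icc.of_isClosed_subset
      (γ.continuousOn.preimage_isClosed_of_isClosed isClosed_Icc hHc) inter_subset_left).diff
      Metric.isOpen_ball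
  have hsrc : ∀ s ∈ J, γ.toFun s ∈ φ.source := fun s hs => disc_subset_source hsq hs.2.2.1
  have hcont : ContinuousOn (fun s => (φ (γ.toFun s)).1) J :=
    continuous_fst.comp_continuousOn
      (φ.continuousOn.comp (γ.continuousOn.mono fun s hs => hs.1) hsrc)
  have hpdisc : p ∈ disc φ := (mem_disc_iff hsq).2 ⟨hpφ, by rw [hφp]; exact zero_mem_modelSquare⟩
  have htJ : t ∈ J := ⟨Ioo_subset_Icc_self ht, htu, by rw [htp]; exact hpdisc, by
    rw [htp, hφp]; rfl⟩
  -- Injectivity holds because $p$ is the only double point in the disc and $u$ is excluded;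
  -- surjectivity because the curve fills the horizontal axis.
  have hbij : BijOn (fun s => (φ (γ.toFun s)).1) J (Icc (-1) 1) := by
    refine ⟨?_, ?_, ?_⟩
    · intro s hs
      exact ((mem_disc_iff hsq).1 hs.2.2.1).2.1
    · intro s hs s' hs' h
      have hγ : γ.toFun s = γ.toFun s' :=
        φ.injOn (hsrc s hs) (hsrc s' hs') (Prod.ext h (hs.2.2.2.trans hs'.2.2.2.symm))
      by_contra hne
      have hd := hdisc _ ⟨s, hs.1, s', hs'.1, hne, rfl, hγ.symm⟩ hs.2.2.1
      rcases hp s hs.1 hd with h1 | h1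
      · rcases hp s' hs'.1 (hγ ▸ hd) with h2 | h2
        · exact hne (h1.trans h2.symm)
        · exact hs'.2.1 h2
      · exact hs.2.1 h1
    · intro x hx
      by_cases hx0 : x = 0
      · refine ⟨t, htJ, ?_⟩
        simp only [htp, hφp, hx0]; rfl
      · have hz : ((x, 0) : ℝ × ℝ) ∈ modelSquare := hHsq ⟨hx, rfl⟩
        have hq : φ.symm (x, 0) ∈ disc φ := ⟨_, hz, rfl⟩
        have hφq : φ (φ.symm (x, 0)) = (x, 0) := φ.right_inv (hsq hz)
        obtain ⟨s, hs, hsq'⟩ := (hcar _ (disc_subset_source hsq hq)).2 (Or.inr (by rw [hφq]))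
        refine ⟨s, ⟨hs, ?_, by rw [hsq']; exact hq, by rw [hsq', hφq]⟩, ?_⟩
        · rintro rfl
          rw [hsq'] at hup
          rw [hup, hφp] at hφq
          exact hx0 (congrArg Prod.fst hφq).symm
        · simp only [hsq', hφq]
  obtain ⟨l, r, hl, hr, hJI, h1, h2⟩ := exists_eq_Icc_of_bijOn_of_deriv hJc hcont hbij htJ
    (by simp [htp, hφp]) (show HasDerivAt (fun s => (φ (γ.toFun s)).1) κ t from hdt.fst)
  exact ⟨l, r, hl, hr, hJI, h1, h2⟩

variable [IsManifold (𝓡∂ 2) ∞ S]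

/-- The images under a crossing chart of the velocities at a double point. -/
theorem exists_deriv_of_isCrossingChart {o : SurfaceOrientation S} {p : S}
    (hp : p ∈ γ.doublePoints) {φ : OpenPartialHomeomorph S (ℝ × ℝ)}
    (hφ : γ.diagram.IsCrossingChart o p φ) :
    ∃ κ κ' : ℝ, HasDerivAt (φ ∘ γ.toFun) (κ, 0) (γ.firstTime p) ∧
      HasDerivAt (φ ∘ γ.toFun) (0, κ') (γ.lastTime p) ∧
      (γ.IsPositive o p → 0 < κ * κ') ∧ (¬ γ.IsPositive o p → κ * κ' < 0) := by
  have hmd : MDifferentiableAt (𝓡∂ 2) 𝓘(ℝ, ℝ × ℝ) φ p :=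
    ((hφ.smooth p hφ.mem_source).mdifferentiableWithinAt (by simp)).mdifferentiableAt
      (φ.open_source.mem_nhds hφ.mem_source)
  have h1 := hasDerivAt_comp (γ := γ) (φ := φ) (firstTime_mem_Ioo hp) (by
    rw [apply_firstTime hp]; exact hmd)
  have h2 := hasDerivAt_comp (γ := γ) (φ := φ) (lastTime_mem_Ioo hp) (by
    rw [apply_lastTime hp]; exact hmd)
  rw [apply_firstTime hp] at h1
  rw [apply_lastTime hp] at h2
  have hov : ((mfderiv (𝓡∂ 2) 𝓘(ℝ, ℝ × ℝ) φ p (pathVelocity γ.toFun (γ.firstTime p)) : ℝ × ℝ)).2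
    = 0 := hφ.over_horizontal
  have hun : ((mfderiv (𝓡∂ 2) 𝓘(ℝ, ℝ × ℝ) φ p (pathVelocity γ.toFun (γ.lastTime p)) : ℝ × ℝ)).1
    = 0 := hφ.under_vertical
  refine ⟨((mfderiv (𝓡∂ 2) 𝓘(ℝ, ℝ × ℝ) φ p (pathVelocity γ.toFun (γ.firstTime p)) : ℝ × ℝ)).1,
    ((mfderiv (𝓡∂ 2) 𝓘(ℝ, ℝ × ℝ) φ p (pathVelocity γ.toFun (γ.lastTime p)) : ℝ × ℝ)).2,
    ?_, ?_, ?_, ?_⟩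
  · rw [← hov]; exact h1
  · rw [← hun]; exact h2
  · intro hpos
    have := hφ.oriented _ _ hpos
    rw [hov, zero_mul, sub_zero] at this
    exact this
  · intro hneg
    -- Here the reversed pair is positive, and its determinant in the chart is $-\kappa\kappa'$.
    have := hφ.oriented _ _ ((isPositivePair_velocity_swap_iff o hp).2 hneg)
    rw [hun, zero_mul, zero_sub, neg_pos, mul_comm] at this
    exact this

/-- The first passage runs from west to east if $\kappa>0$ and from east to west otherwise; the
second from south to north if $\kappa'>0$, else from north to south. Comparing with the ends of the
model arcs, type $A$ pairs entries with exits when $\kappa\kappa'>0$, type $B$ when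
$\kappa\kappa'<0$. -/
theorem exists_isLocalSplitting [T2Space S] {o : SurfaceOrientation S} {p : S}
    (hp : p ∈ γ.doublePoints) {φ : OpenPartialHomeomorph S (ℝ × ℝ)}
    (hφ : γ.diagram.IsCrossingChart o p φ)
    (hdisc : ∀ q ∈ γ.doublePoints, q ∈ disc φ → q = p) {σ : SplitType} {m : Set (ℝ × ℝ)}
    (hm : IsModelSplitting σ m) :
    ∃ l r arc, IsLocalSplitting γ p (disc φ) (φ.symm '' m) (γ.IsCoherent o p σ) l r arc := by
  obtain ⟨κ, κ', hdt, hdu, hpos, hneg⟩ := exists_deriv_of_isCrossingChart hp hφ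
  set t := γ.firstTime p with ht_def
  set u := γ.lastTime p with hu_def
  have ht : t ∈ Ioo (0 : ℝ) 1 := firstTime_mem_Ioo hp
  have hu : u ∈ Ioo (0 : ℝ) 1 := lastTime_mem_Ioo hp
  have htp : γ.toFun t = p := apply_firstTime hp
  have hup : γ.toFun u = p := apply_lastTime hp
  have htu : t < u := (times_lt hp).2.1
  have hκκ' : κ * κ' ≠ 0 := by
    by_cases h : γ.IsPositive o p
    · exact (hpos h).ne'
    · exact (hneg h).ne
  have hκ : κ ≠ 0 := left_ne_zero_of_mul hκκ'
  have hκ' : κ' ≠ 0 := right_ne_zero_of_mul hκκ'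
  obtain ⟨t₁, t₂, ht₁, ht₂, htJ, htpos, htneg⟩ := exists_horizontal_interval hφ.mem_source
    hφ.map_center hφ.square_subset hφ.mem_carrier_iff hdisc ht htu.ne htp hup
    (fun s hs h => eq_firstTime_or_lastTime hp hs h) hdt hdu hκ'
  -- Exchanging the coordinates turns the vertical strand into a horizontal one. Orientation plays
  -- no role in `exists_horizontal_interval`.
  let φ' := φ.transHomeomorph (Homeomorph.prodComm ℝ ℝ)
  have hφ' : ∀ q, φ' q = ((φ q).2, (φ q).1) := fun _ => rfl
  have hswap : ∀ {v : ℝ × ℝ} {s : ℝ}, HasDerivAt (φ ∘ γ.toFun) v s →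
      HasDerivAt (φ' ∘ γ.toFun) (v.2, v.1) s := fun h => h.snd.prodMk h.fst
  have hsq' : modelSquare ⊆ φ'.target := fun z hz => hφ.square_subset ⟨hz.2, hz.1⟩
  have hdisc' : disc φ' = disc φ := by
    ext q
    rw [mem_disc_iff hsq', mem_disc_iff hφ.square_subset]
    exact and_congr_right fun _ => and_comm
  obtain ⟨u₁, u₂, hu₁, hu₂, huJ, hupos, huneg⟩ := exists_horizontal_interval (φ := φ') (p := p)
    hφ.mem_source (by rw [hφ', hφ.map_center]; rfl) hsq'
    (fun q hq => (hφ.mem_carrier_iff q hq).trans or_comm) (hdisc' ▸ hdisc) hu htu.ne' hup htp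
    (fun s hs h => (eq_firstTime_or_lastTime hp hs h).symm) (hswap hdu) (hswap hdt) hκ
  rw [hdisc'] at huJ
  simp only [hφ'] at huJ hupos huneg
  have hmt : ∀ s ∈ Icc t₁ t₂, s ∈ Icc (0 : ℝ) 1 ∧ s ≠ u ∧ γ.toFun s ∈ disc φ ∧
      (φ (γ.toFun s)).2 = 0 := fun s hs => by rw [← htJ] at hs; exact hs
  have hmu : ∀ s ∈ Icc u₁ u₂, s ∈ Icc (0 : ℝ) 1 ∧ s ≠ t ∧ γ.toFun s ∈ disc φ ∧
      (φ (γ.toFun s)).1 = 0 := fun s hs => by rw [← huJ] at hs; exact hs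
  have hpre : Icc (0 : ℝ) 1 ∩ γ.toFun ⁻¹' disc φ = Icc t₁ t₂ ∪ Icc u₁ u₂ := by
    ext s
    constructor
    · rintro ⟨hs, hsd⟩
      by_cases hst : s = t
      · exact Or.inl (hst ▸ ⟨ht₁.le, ht₂.le⟩)
      by_cases hsu : s = u
      · exact Or.inr (hsu ▸ ⟨hu₁.le, hu₂.le⟩)
      rcases (hφ.mem_carrier_iff _ (disc_subset_source hφ.square_subset hsd)).1 ⟨s, hs, rfl⟩
        with h | h
      · right; rw [← huJ]; exact ⟨hs, hst, hsd, h⟩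
      · left; rw [← htJ]; exact ⟨hs, hsu, hsd, h⟩
    · rintro (h | h)
      · exact ⟨(hmt s h).1, (hmt s h).2.2.1⟩
      · exact ⟨(hmu s h).1, (hmu s h).2.2.1⟩
  have hdj : Disjoint (Icc t₁ t₂) (Icc u₁ u₂) := by
    rw [Set.disjoint_left]
    intro s hs hs'
    obtain ⟨a1, a2, a3, a4⟩ := hmt s hs
    obtain ⟨b1, b2, b3, b4⟩ := hmu s hs'
    have : γ.toFun s = p := φ.injOn (disc_subset_source hφ.square_subset a3) hφ.mem_source
      (by rw [hφ.map_center]; exact Prod.ext b4 a4)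
    rcases eq_firstTime_or_lastTime hp a1 this with h | h
    · exact b2 h
    · exact a2 h
  have hpt : ∀ s z, γ.toFun s ∈ disc φ → φ (γ.toFun s) = z → γ.toFun s = φ.symm z := by
    rintro s _ hs rfl
    exact (φ.left_inv (disc_subset_source hφ.square_subset hs)).symm
  have et₁ := hmt t₁ ⟨le_rfl, (ht₁.trans ht₂).le⟩
  have et₂ := hmt t₂ ⟨(ht₁.trans ht₂).le, le_rfl⟩
  have eu₁ := hmu u₁ ⟨le_rfl, (hu₁.trans hu₂).le⟩
  have eu₂ := hmu u₂ ⟨(hu₁.trans hu₂).le, le_rfl⟩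
  -- The arcs are named by the first passage: $a$ contains its entry, $b$ its exit.
  have key : ∀ (a b : Set (ℝ × ℝ)) {x₁ y₁ x₂ y₂ : ℝ × ℝ}, IsModelArc a x₁ y₁ → IsModelArc b x₂ y₂ →
      Disjoint a b → m = a ∪ b → γ.toFun t₁ ∈ φ.symm '' a → γ.toFun t₂ ∈ φ.symm '' b →
      (γ.IsCoherent o p σ → γ.toFun u₁ ∈ φ.symm '' b ∧ γ.toFun u₂ ∈ φ.symm '' a) →
      (¬ γ.IsCoherent o p σ → γ.toFun u₁ ∈ φ.symm '' a ∧ γ.toFun u₂ ∈ φ.symm '' b) →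
      ∃ l r arc, IsLocalSplitting γ p (disc φ) (φ.symm '' m) (γ.IsCoherent o p σ) l r arc := by
    intro a b x₁ y₁ x₂ y₂ ha hb hab hmab h1 h2 h3 h4
    have hcs : ContinuousOn φ.symm modelSquare := φ.continuousOn_symm.mono hφ.square_subset
    refine ⟨fun b => bif b then u₁ else t₁, fun b => bif b then u₂ else t₂,
      fun e => bif e then φ.symm '' b else φ.symm '' a, ?_, ?_, hpre, hdj, ?_, ?_, ?_, ?_, h1, h2,
      h3, h4⟩
    · rintro (_ | _)
      exacts [ht₁, hu₁]
    · rintro (_ | _)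
      exacts [ht₂, hu₂]
    · rintro (_ | _)
      exacts [ha.isCompact.image_of_continuousOn (hcs.mono ha.1),
        hb.isCompact.image_of_continuousOn (hcs.mono hb.1)]
    · rintro (_ | _)
      exacts [ha.isConnected.image _ (hcs.mono ha.1), hb.isConnected.image _ (hcs.mono hb.1)]
    · refine disjoint_image_image fun x hx y hy hxy => hab.ne_of_mem hx hy ?_
      exact φ.symm.injOn (hφ.square_subset (ha.1 hx)) (hφ.square_subset (hb.1 hy)) hxy
    · rw [hmab, image_union]; rfl
  have hpos' : 0 < κ * κ' → γ.IsPositive o p := fun h => by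
    by_contra h'; exact h.not_gt (hneg h')
  have hneg' : κ * κ' < 0 → ¬ γ.IsPositive o p := fun h h' => h.not_gt (hpos h')
  -- When $\kappa<0$ the first passage enters from the east, which is on the second model arc for
  -- both types, so `key` is applied with the arcs exchanged.
  rcases lt_or_gt_of_ne hκ with hk | hk <;> rcases lt_or_gt_of_ne hκ' with hk' | hk'
  · have P := hpos' (mul_pos_of_neg_of_neg hk hk')
    have T₁ := hpt t₁ (1, 0) et₁.2.2.1 (Prod.ext (htneg hk).1 et₁.2.2.2)
    have T₂ := hpt t₂ (-1, 0) et₂.2.2.1 (Prod.ext (htneg hk).2 et₂.2.2.2)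
    have U₁ := hpt u₁ (0, 1) eu₁.2.2.1 (Prod.ext eu₁.2.2.2 (huneg hk').1)
    have U₂ := hpt u₂ (0, -1) eu₂.2.2.1 (Prod.ext eu₂.2.2.2 (huneg hk').2)
    cases σ with
    | A =>
      obtain ⟨a, b, ha, hb, hab, hmab⟩ := hm
      exact key b a hb ha hab.symm (hmab.trans (union_comm a b)) ⟨_, hb.right_mem, T₁.symm⟩
        ⟨_, ha.left_mem, T₂.symm⟩
        (fun _ => ⟨⟨_, ha.right_mem, U₁.symm⟩, ⟨_, hb.left_mem, U₂.symm⟩⟩)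
        (fun h => absurd (Or.inl ⟨rfl, P⟩) h)
    | B =>
      obtain ⟨a, b, ha, hb, hab, hmab⟩ := hm
      exact key b a hb ha hab.symm (hmab.trans (union_comm a b)) ⟨_, hb.right_mem, T₁.symm⟩
        ⟨_, ha.left_mem, T₂.symm⟩ (fun h => by simp [IsCoherent, P] at h)
        (fun _ => ⟨⟨_, hb.left_mem, U₁.symm⟩, ⟨_, ha.right_mem, U₂.symm⟩⟩)
  · have P := hneg' (mul_neg_of_neg_of_pos hk hk')
    have T₁ := hpt t₁ (1, 0) et₁.2.2.1 (Prod.ext (htneg hk).1 et₁.2.2.2)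
    have T₂ := hpt t₂ (-1, 0) et₂.2.2.1 (Prod.ext (htneg hk).2 et₂.2.2.2)
    have U₁ := hpt u₁ (0, -1) eu₁.2.2.1 (Prod.ext eu₁.2.2.2 (hupos hk').1)
    have U₂ := hpt u₂ (0, 1) eu₂.2.2.1 (Prod.ext eu₂.2.2.2 (hupos hk').2)
    cases σ with
    | A =>
      obtain ⟨a, b, ha, hb, hab, hmab⟩ := hm
      exact key b a hb ha hab.symm (hmab.trans (union_comm a b)) ⟨_, hb.right_mem, T₁.symm⟩
        ⟨_, ha.left_mem, T₂.symm⟩ (fun h => by simp [IsCoherent, P] at h)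
        (fun _ => ⟨⟨_, hb.left_mem, U₁.symm⟩, ⟨_, ha.right_mem, U₂.symm⟩⟩)
    | B =>
      obtain ⟨a, b, ha, hb, hab, hmab⟩ := hm
      exact key b a hb ha hab.symm (hmab.trans (union_comm a b)) ⟨_, hb.right_mem, T₁.symm⟩
        ⟨_, ha.left_mem, T₂.symm⟩
        (fun _ => ⟨⟨_, ha.right_mem, U₁.symm⟩, ⟨_, hb.left_mem, U₂.symm⟩⟩)
        (fun h => absurd (Or.inr ⟨rfl, P⟩) h)
  · have P := hneg' (mul_neg_of_pos_of_neg hk hk')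
    have T₁ := hpt t₁ (-1, 0) et₁.2.2.1 (Prod.ext (htpos hk).1 et₁.2.2.2)
    have T₂ := hpt t₂ (1, 0) et₂.2.2.1 (Prod.ext (htpos hk).2 et₂.2.2.2)
    have U₁ := hpt u₁ (0, 1) eu₁.2.2.1 (Prod.ext eu₁.2.2.2 (huneg hk').1)
    have U₂ := hpt u₂ (0, -1) eu₂.2.2.1 (Prod.ext eu₂.2.2.2 (huneg hk').2)
    cases σ with
    | A =>
      obtain ⟨a, b, ha, hb, hab, hmab⟩ := hm
      exact key a b ha hb hab hmab ⟨_, ha.left_mem, T₁.symm⟩ ⟨_, hb.right_mem, T₂.symm⟩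
        (fun h => by simp [IsCoherent, P] at h)
        (fun _ => ⟨⟨_, ha.right_mem, U₁.symm⟩, ⟨_, hb.left_mem, U₂.symm⟩⟩)
    | B =>
      obtain ⟨a, b, ha, hb, hab, hmab⟩ := hm
      exact key a b ha hb hab hmab ⟨_, ha.left_mem, T₁.symm⟩ ⟨_, hb.right_mem, T₂.symm⟩
        (fun _ => ⟨⟨_, hb.left_mem, U₁.symm⟩, ⟨_, ha.right_mem, U₂.symm⟩⟩)
        (fun h => absurd (Or.inr ⟨rfl, P⟩) h)
  · have P := hpos' (mul_pos hk hk')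
    have T₁ := hpt t₁ (-1, 0) et₁.2.2.1 (Prod.ext (htpos hk).1 et₁.2.2.2)
    have T₂ := hpt t₂ (1, 0) et₂.2.2.1 (Prod.ext (htpos hk).2 et₂.2.2.2)
    have U₁ := hpt u₁ (0, -1) eu₁.2.2.1 (Prod.ext eu₁.2.2.2 (hupos hk').1)
    have U₂ := hpt u₂ (0, 1) eu₂.2.2.1 (Prod.ext eu₂.2.2.2 (hupos hk').2)
    cases σ with
    | A =>
      obtain ⟨a, b, ha, hb, hab, hmab⟩ := hm
      exact key a b ha hb hab hmab ⟨_, ha.left_mem, T₁.symm⟩ ⟨_, hb.right_mem, T₂.symm⟩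
        (fun _ => ⟨⟨_, hb.left_mem, U₁.symm⟩, ⟨_, ha.right_mem, U₂.symm⟩⟩)
        (fun h => absurd (Or.inl ⟨rfl, P⟩) h)
    | B =>
      obtain ⟨a, b, ha, hb, hab, hmab⟩ := hm
      exact key a b ha hb hab hmab ⟨_, ha.left_mem, T₁.symm⟩ ⟨_, hb.right_mem, T₂.symm⟩
        (fun h => by simp [IsCoherent, P] at h)
        (fun _ => ⟨⟨_, ha.right_mem, U₁.symm⟩, ⟨_, hb.left_mem, U₂.symm⟩⟩)

end SurfaceCurve

/-! ### The positions of the times of the double points -/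

namespace SurfaceCurve

variable {S : Type*} [TopologicalSpace S] [ChartedSpace (EuclideanHalfSpace 2) S]
  {γ : SurfaceCurve S}

theorem time_mem_Icc {p : S} (hp : p ∈ γ.doublePoints) (b : Bool) :
    γ.time p b ∈ Icc (0 : ℝ) 1 := by
  cases b
  exacts [Ioo_subset_Icc_self (firstTime_mem_Ioo hp), Ioo_subset_Icc_self (lastTime_mem_Ioo hp)]

theorem apply_time {p : S} (hp : p ∈ γ.doublePoints) (b : Bool) : γ.toFun (γ.time p b) = p := by
  cases b
  exacts [apply_firstTime hp, apply_lastTime hp]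

theorem time_mem_doubleTimes {p : S} (hp : p ∈ γ.doublePoints) (b : Bool) :
    γ.time p b ∈ γ.doubleTimes :=
  ⟨time_mem_Icc hp b, by rw [apply_time hp]; exact hp⟩

theorem exists_eq_time {s : ℝ} (hs : s ∈ γ.doubleTimes) : ∃ b, s = γ.time (γ.toFun s) b := by
  rcases eq_firstTime_or_lastTime hs.2 hs.1 rfl with h | h
  exacts [⟨false, h⟩, ⟨true, h⟩]

theorem time_inj {p : S} (hp : p ∈ γ.doublePoints) {b c : Bool} (h : γ.time p b = γ.time p c) :
    b = c := by
  have := (times_lt hp).2.1.ne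
  cases b <;> cases c
  exacts [rfl, absurd h this, absurd h.symm this, rfl]

/-- The times of the double points correspond to pairs of a double point and a strand. -/
theorem bijective_time : Function.Bijective
    fun z : γ.doublePoints × Bool => (⟨γ.time z.1 z.2, time_mem_doubleTimes z.1.2 z.2⟩ :
      γ.doubleTimes) := by
  constructor
  · rintro ⟨⟨p, hp⟩, b⟩ ⟨⟨q, hq⟩, c⟩ h
    have h' : γ.time p b = γ.time q c := congrArg Subtype.val h
    have hpq : p = q := by rw [← apply_time hp b, h', apply_time hq]
    subst hpq
    rw [time_inj hp h']
  · rintro ⟨s, hs⟩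
    obtain ⟨b, hb⟩ := exists_eq_time hs
    exact ⟨(⟨γ.toFun s, hs.2⟩, b), Subtype.ext hb.symm⟩

theorem ncard_doubleTimes : γ.doubleTimes.ncard = 2 * γ.numDoublePoints := by
  rw [numDoublePoints, ← Nat.card_coe_set_eq, ← Nat.card_coe_set_eq,
    ← Nat.card_eq_of_bijective _ bijective_time, Nat.card_prod]
  simp [mul_comm]

theorem finite_doubleTimes (hfin : γ.doublePoints.Finite) : γ.doubleTimes.Finite := by
  have := hfin.to_subtype
  exact Set.finite_coe_iff.1 (Finite.of_surjective _ bijective_time.2)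

theorem timeIndex_mono (hfin : γ.doublePoints.Finite) : Monotone γ.timeIndex := fun _ _ h =>
  ncard_le_ncard (fun _ hu => ⟨hu.1, hu.2.trans h⟩)
    ((finite_doubleTimes hfin).subset (sep_subset _ _))

theorem timeIndex_le (hfin : γ.doublePoints.Finite) (s : ℝ) :
    γ.timeIndex s ≤ 2 * γ.numDoublePoints := by
  rw [← ncard_doubleTimes]
  exact ncard_le_ncard (sep_subset _ _) (finite_doubleTimes hfin)

theorem timeIndex_congr {a b : ℝ} (h : ∀ τ ∈ γ.doubleTimes, τ ≤ a ↔ τ ≤ b) :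
    γ.timeIndex a = γ.timeIndex b := by
  rw [timeIndex, timeIndex]
  congr 1
  ext τ
  exact and_congr_right (h τ)

/-- Nested finite sets of equal size coincide, so no double time lies in $(a,b]$. -/
theorem le_of_timeIndex_eq (hfin : γ.doublePoints.Finite) {a b : ℝ} (hab : a ≤ b)
    (h : γ.timeIndex a = γ.timeIndex b) {τ : ℝ} (hτ : τ ∈ γ.doubleTimes) (hb : τ ≤ b) : τ ≤ a := by
  have hsub : {u ∈ γ.doubleTimes | u ≤ a} ⊆ {u ∈ γ.doubleTimes | u ≤ b} :=
    fun u hu => ⟨hu.1, hu.2.trans hab⟩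
  have heq := eq_of_subset_of_ncard_le hsub h.symm.le
    ((finite_doubleTimes hfin).subset (sep_subset _ _))
  have : τ ∈ {u ∈ γ.doubleTimes | u ≤ b} := ⟨hτ, hb⟩
  rw [← heq] at this
  exact this.2

theorem timeIndex_eq_succ (hfin : γ.doublePoints.Finite) {a τ : ℝ} (hτ : τ ∈ γ.doubleTimes)
    (ha : a < τ) (h : ∀ u ∈ γ.doubleTimes, u < τ → u ≤ a) :
    γ.timeIndex τ = γ.timeIndex a + 1 := by
  rw [timeIndex, timeIndex]
  have : {u ∈ γ.doubleTimes | u ≤ τ} = insert τ {u ∈ γ.doubleTimes | u ≤ a} := by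
    ext u
    constructor
    · rintro ⟨hu, hle⟩
      rcases hle.eq_or_lt with h' | h'
      · exact Or.inl h'
      · exact Or.inr ⟨hu, h u hu h'⟩
    · rintro (rfl | ⟨hu, hle⟩)
      · exact ⟨hτ, le_rfl⟩
      · exact ⟨hu, hle.trans ha.le⟩
  rw [this, ncard_insert_of_notMem (a := τ) (fun hm => ha.not_ge hm.2)
    ((finite_doubleTimes hfin).subset (sep_subset _ _))]

theorem timeIndex_strictMonoOn (hfin : γ.doublePoints.Finite) :
    StrictMonoOn γ.timeIndex γ.doubleTimes := by
  intro a _ b hb hab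
  refine lt_of_le_of_ne (timeIndex_mono hfin hab.le) fun h => ?_
  exact hab.not_ge (le_of_timeIndex_eq hfin hab.le h hb le_rfl)

theorem timeIndex_firstTime_lt (hfin : γ.doublePoints.Finite) {p : S} (hp : p ∈ γ.doublePoints) :
    γ.timeIndex (γ.firstTime p) < γ.timeIndex (γ.lastTime p) :=
  timeIndex_strictMonoOn hfin (time_mem_doubleTimes hp false) (time_mem_doubleTimes hp true)
    (times_lt hp).2.1

theorem timeIndex_pos (hfin : γ.doublePoints.Finite) {τ : ℝ} (hτ : τ ∈ γ.doubleTimes) :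
    0 < γ.timeIndex τ :=
  (ncard_pos ((finite_doubleTimes hfin).subset (sep_subset _ _))).2 ⟨τ, hτ, le_rfl⟩

/-- The index is injective on the $2d$ double times and takes values in a set of $2d$ elements. -/
theorem image_timeIndex (hfin : γ.doublePoints.Finite) :
    γ.timeIndex '' γ.doubleTimes = Icc 1 (2 * γ.numDoublePoints) := by
  refine eq_of_subset_of_ncard_le ?_ ?_ (finite_Icc _ _)
  · rintro _ ⟨τ, hτ, rfl⟩
    exact ⟨timeIndex_pos hfin hτ, timeIndex_le hfin τ⟩
  · rw [(timeIndex_strictMonoOn hfin).injOn.ncard_image, ncard_doubleTimes]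
    simp [← Nat.card_coe_set_eq]

theorem timeIndex_zero : γ.timeIndex 0 = 0 := by
  have : {u ∈ γ.doubleTimes | u ≤ 0} = ∅ := by
    refine eq_empty_of_forall_notMem fun u hu => ?_
    obtain ⟨b, hb⟩ := exists_eq_time hu.1
    have h0 := times_lt hu.1.2
    have := hu.2
    rw [hb] at this
    cases b
    · exact absurd this h0.1.not_ge
    · exact absurd this (h0.1.trans h0.2.1).not_ge
  rw [timeIndex, this, ncard_empty]

/-! ### The pieces of a split curve -/

/-- The permutations which join the two strands through a double point: `i` and `j` are the
positions of its two times. -/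
noncomputable def _root_.ChordDiagram.joins (d i j : ℕ) (coherent : Prop) :
    Set (Equiv.Perm (Fin (2 * d + 1))) :=
  {g | (coherent ∧ (g = ChordDiagram.transposition d i (j - 1) ∨
      g = ChordDiagram.transposition d (i - 1) j)) ∨
    (¬ coherent ∧ (g = ChordDiagram.transposition d i j ∨
      g = ChordDiagram.transposition d (i - 1) (j - 1)))}

/-- Local splittings at all the double points, in disjoint discs. -/
structure IsSplittingData (γ : SurfaceCurve S) (Δ m : γ.doublePoints → Set S)
    (coherent : γ.doublePoints → Prop) (l r : γ.doublePoints → Bool → ℝ)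
    (arc : γ.doublePoints → Bool → Set S) : Prop where
  local_splitting : ∀ p : γ.doublePoints,
    γ.IsLocalSplitting p (Δ p) (m p) (coherent p) (l p) (r p) (arc p)
  disjoint : ∀ p q, p ≠ q → Disjoint (Δ p) (Δ q)
  subset : ∀ p, m p ⊆ Δ p

/-! ### Passages of the curve through the discs. -/

namespace IsSplittingData

variable {Δ m : γ.doublePoints → Set S} {coherent : γ.doublePoints → Prop}
  {l r : γ.doublePoints → Bool → ℝ} {arc : γ.doublePoints → Bool → Set S}

theorem mem_of_mem_Icc (H : IsSplittingData γ Δ m coherent l r arc) {p : γ.doublePoints}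
    {b : Bool} {s : ℝ} (hs : s ∈ Icc (l p b) (r p b)) :
    s ∈ Icc (0 : ℝ) 1 ∧ γ.toFun s ∈ Δ p := by
  have : s ∈ Icc (0 : ℝ) 1 ∩ γ.toFun ⁻¹' Δ p := by
    rw [(H.local_splitting p).preimage_eq]
    cases b
    exacts [Or.inl hs, Or.inr hs]
  exact this

theorem exists_mem_Icc (H : IsSplittingData γ Δ m coherent l r arc) {p : γ.doublePoints} {s : ℝ}
    (hs : s ∈ Icc (0 : ℝ) 1) (hd : γ.toFun s ∈ Δ p) : ∃ b, s ∈ Icc (l p b) (r p b) := by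
  have : s ∈ Icc (0 : ℝ) 1 ∩ γ.toFun ⁻¹' Δ p := ⟨hs, hd⟩
  rw [(H.local_splitting p).preimage_eq] at this
  exact this.elim (fun h => ⟨false, h⟩) (fun h => ⟨true, h⟩)

/-- Different discs are disjoint, and so are the two passages through the same disc. -/
theorem eq_of_mem_Icc (H : IsSplittingData γ Δ m coherent l r arc) {p q : γ.doublePoints}
    {b c : Bool} {s : ℝ} (hs : s ∈ Icc (l p b) (r p b)) (hs' : s ∈ Icc (l q c) (r q c)) :
    p = q ∧ b = c := by
  have hpq : p = q := by
    by_contra hne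
    exact Set.disjoint_left.1 (H.disjoint p q hne) (H.mem_of_mem_Icc hs).2 (H.mem_of_mem_Icc hs').2
  subst hpq
  refine ⟨rfl, ?_⟩
  have hd := Set.disjoint_left.1 (H.local_splitting p).disjoint
  cases b <;> cases c
  exacts [rfl, absurd hs' (hd hs), absurd hs (hd hs'), rfl]

theorem time_mem (H : IsSplittingData γ Δ m coherent l r arc) (p : γ.doublePoints) (b : Bool) :
    γ.time p b ∈ Ioo (l p b) (r p b) :=
  ⟨(H.local_splitting p).left_lt b, (H.local_splitting p).lt_right b⟩

theorem left_le_right (H : IsSplittingData γ Δ m coherent l r arc) (p : γ.doublePoints)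
    (b : Bool) : l p b ≤ r p b :=
  ((H.time_mem p b).1.trans (H.time_mem p b).2).le

theorem eq_time_of_mem_Icc (H : IsSplittingData γ Δ m coherent l r arc) {p : γ.doublePoints}
    {b : Bool} {τ : ℝ} (hτ : τ ∈ γ.doubleTimes) (h : τ ∈ Icc (l p b) (r p b)) :
    τ = γ.time p b := by
  obtain ⟨c, hc⟩ := exists_eq_time hτ
  have h' := Ioo_subset_Icc_self (H.time_mem ⟨γ.toFun τ, hτ.2⟩ c)
  rw [← hc] at h'
  obtain ⟨rfl, rfl⟩ := H.eq_of_mem_Icc h h'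
  exact hc

/-- A passage contains no double time but its own. So a disc is left with index $i$ and, by
`timeIndex_left`, entered with index $i-1$; these are the letters occurring in $R_c$. -/
theorem timeIndex_right (H : IsSplittingData γ Δ m coherent l r arc) (p : γ.doublePoints)
    (b : Bool) : γ.timeIndex (r p b) = γ.timeIndex (γ.time p b) := by
  refine timeIndex_congr fun τ hτ => ⟨fun h => ?_, fun h => h.trans (H.time_mem p b).2.le⟩
  by_contra hlt
  push Not at hlt
  exact hlt.ne' (H.eq_time_of_mem_Icc hτ ⟨((H.time_mem p b).1.trans hlt).le, h⟩)

theorem timeIndex_left (H : IsSplittingData γ Δ m coherent l r arc)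
    (hfin : γ.doublePoints.Finite) (p : γ.doublePoints) (b : Bool) :
    γ.timeIndex (l p b) = γ.timeIndex (γ.time p b) - 1 := by
  -- The index at a double time is a successor, so the subtraction is not truncated.
  rw [timeIndex_eq_succ hfin (time_mem_doubleTimes p.2 b) (H.time_mem p b).1, Nat.add_sub_cancel]
  intro u hu hlt
  by_contra hle
  push Not at hle
  exact hlt.ne (H.eq_time_of_mem_Icc hu ⟨hle.le, (hlt.trans (H.time_mem p b).2).le⟩)

end IsSplittingData

/-- The times at which the curve is not in the interior of one of the discs. -/
def outerTimes (γ : SurfaceCurve S) (l r : γ.doublePoints → Bool → ℝ) : Set ℝ :=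
  {x ∈ Icc (0 : ℝ) 1 | ∀ p b, x ∉ Ioo (l p b) (r p b)}

/-- The part of the curve between the `n`-th and the next double point, outside the discs. -/
def outerPiece (γ : SurfaceCurve S) (l r : γ.doublePoints → Bool → ℝ) (n : ℕ) : Set S :=
  γ.toFun '' {x ∈ γ.outerTimes l r | γ.timeIndex x = n}

/-! ### Pieces of the split curve and their incidences. -/

namespace IsSplittingData

variable {Δ m : γ.doublePoints → Set S} {coherent : γ.doublePoints → Prop}
  {l r : γ.doublePoints → Bool → ℝ} {arc : γ.doublePoints → Bool → Set S}

theorem left_mem_outerTimes (H : IsSplittingData γ Δ m coherent l r arc) (p : γ.doublePoints)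
    (b : Bool) : l p b ∈ γ.outerTimes l r := by
  have hm : l p b ∈ Icc (l p b) (r p b) := left_mem_Icc.2 (H.left_le_right p b)
  refine ⟨(H.mem_of_mem_Icc hm).1, fun q c h => ?_⟩
  obtain ⟨rfl, rfl⟩ := H.eq_of_mem_Icc hm (Ioo_subset_Icc_self h)
  exact lt_irrefl _ h.1

theorem right_mem_outerTimes (H : IsSplittingData γ Δ m coherent l r arc) (p : γ.doublePoints)
    (b : Bool) : r p b ∈ γ.outerTimes l r := by
  have hm : r p b ∈ Icc (l p b) (r p b) := right_mem_Icc.2 (H.left_le_right p b)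
  refine ⟨(H.mem_of_mem_Icc hm).1, fun q c h => ?_⟩
  obtain ⟨rfl, rfl⟩ := H.eq_of_mem_Icc hm (Ioo_subset_Icc_self h)
  exact lt_irrefl _ h.2

/-- Every double time is interior to its passage. Consequently the curve is injective on the outer
times. -/
theorem notMem_doublePoints (H : IsSplittingData γ Δ m coherent l r arc) {x : ℝ}
    (hx : x ∈ γ.outerTimes l r) : γ.toFun x ∉ γ.doublePoints := by
  intro h
  obtain ⟨b, hb⟩ := exists_eq_time (γ := γ) ⟨hx.1, h⟩
  refine hx.2 ⟨_, h⟩ b ?_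
  have := H.time_mem ⟨_, h⟩ b
  rwa [← hb] at this

theorem eq_left_or_right (H : IsSplittingData γ Δ m coherent l r arc) {x : ℝ}
    (hx : x ∈ γ.outerTimes l r) {p : γ.doublePoints} (hd : γ.toFun x ∈ Δ p) :
    ∃ b, x = l p b ∨ x = r p b := by
  obtain ⟨b, hb⟩ := H.exists_mem_Icc hx.1 hd
  refine ⟨b, ?_⟩
  by_contra hne
  push Not at hne
  exact hx.2 p b ⟨lt_of_le_of_ne hb.1 hne.1.symm, lt_of_le_of_ne hb.2 hne.2⟩

theorem isConnected_outerPiece (H : IsSplittingData γ Δ m coherent l r arc)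
    (hfin : γ.doublePoints.Finite) {n : ℕ} (hn : n ≤ 2 * γ.numDoublePoints) :
    IsConnected (γ.outerPiece l r n) := by
  refine IsConnected.image ⟨?_, ?_⟩ _ (γ.continuousOn.mono fun x hx => hx.1.1)
  · rcases Nat.eq_zero_or_pos n with rfl | hpos
    -- The piece $0$ contains the start of the curve; the piece $n>0$ contains the exit after the
    -- $n$-th double time.
    · refine ⟨0, ⟨⟨le_rfl, zero_le_one⟩, fun p b h => ?_⟩, timeIndex_zero⟩
      exact h.1.not_ge (H.left_mem_outerTimes p b).1.1
    · have : n ∈ γ.timeIndex '' γ.doubleTimes := by rw [image_timeIndex hfin]; exact ⟨hpos, hn⟩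
      obtain ⟨τ, hτ, rfl⟩ := this
      obtain ⟨b, hb⟩ := exists_eq_time hτ
      refine ⟨r ⟨_, hτ.2⟩ b, H.right_mem_outerTimes _ _, ?_⟩
      rw [H.timeIndex_right]
      exact congrArg γ.timeIndex hb.symm
  · refine OrdConnected.isPreconnected ⟨fun x hx y hy z hz => ?_⟩
    have hxz : γ.timeIndex x = γ.timeIndex z := le_antisymm (timeIndex_mono hfin hz.1)
      ((timeIndex_mono hfin hz.2).trans_eq (hy.2.trans hx.2.symm))
    have hzy : γ.timeIndex z = γ.timeIndex y := hxz.symm.trans (hx.2.trans hy.2.symm)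
    refine ⟨⟨⟨hx.1.1.1.trans hz.1, hz.2.trans hy.1.1.2⟩, fun p b h => ?_⟩, hxz.symm.trans hx.2⟩
    have hτ := time_mem_doubleTimes p.2 b
    -- If $z$ were inside a passage, then, the index being constant on $[x,y]$, the double time of
    -- that passage would be at most $x$ or greater than $y$. Then $x$ or $y$ would lie in the same
    -- open passage.
    rcases le_or_gt (γ.time p b) z with hle | hlt
    · have := le_of_timeIndex_eq hfin hz.1 hxz hτ hle
      exact hx.1.2 p b ⟨(H.time_mem p b).1.trans_le this, hz.1.trans_lt h.2⟩
    · have : y < γ.time p b := by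
        by_contra hge
        exact hlt.not_ge (le_of_timeIndex_eq hfin hz.2 hzy hτ (not_lt.1 hge))
      exact hy.1.2 p b ⟨h.1.trans_le hz.2, this.trans (H.time_mem p b).2⟩

/-- The outer times are closed and contain no double time, and away from the double times the index
is locally constant. -/
theorem isCompact_outerPiece (H : IsSplittingData γ Δ m coherent l r arc)
    (hfin : γ.doublePoints.Finite) (n : ℕ) : IsCompact (γ.outerPiece l r n) := by
  refine IsCompact.image_of_continuousOn ?_ (γ.continuousOn.mono fun x hx => hx.1.1)
  have hK : IsClosed (γ.outerTimes l r) := by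
    have : γ.outerTimes l r = Icc (0 : ℝ) 1 ∩ (⋃ p, ⋃ b, Ioo (l p b) (r p b))ᶜ := by
      ext x; simp [outerTimes]
    rw [this]
    exact isClosed_Icc.inter (isOpen_iUnion fun p => isOpen_iUnion fun b => isOpen_Ioo).isClosed_compl
  have hc : ContinuousOn γ.timeIndex (γ.outerTimes l r) := by
    intro x hx
    have hx' : ∀ τ ∈ γ.doubleTimes, x ≠ τ := by
      rintro τ hτ rfl
      exact H.notMem_doublePoints hx hτ.2
    have hev : ∀ᶠ y in 𝓝 x, ∀ τ ∈ γ.doubleTimes, τ ≤ y ↔ τ ≤ x := by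
      rw [eventually_all_finite (finite_doubleTimes hfin)]
      intro τ hτ
      rcases lt_or_gt_of_ne (hx' τ hτ) with h | h
      · filter_upwards [Iio_mem_nhds h] with y hy
        exact iff_of_false (not_le.2 hy) (not_le.2 h)
      · filter_upwards [Ioi_mem_nhds h] with y hy
        exact iff_of_true (le_of_lt hy) h.le
    refine ContinuousAt.continuousWithinAt ?_
    refine continuousAt_const.congr (f := fun _ => γ.timeIndex x) ?_
    filter_upwards [hev] with y hy
    exact (timeIndex_congr hy).symm
  have := hc.preimage_isClosed_of_isClosed hK (isClosed_discrete {n})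
  exact isCompact_Icc.of_isClosed_subset this fun x hx => hx.1.1

theorem timeIndex_eq_of_mem_outerPiece (H : IsSplittingData γ Δ m coherent l r arc) {x : ℝ}
    (hx : x ∈ γ.outerTimes l r) {n : ℕ} (hn : γ.toFun x ∈ γ.outerPiece l r n) :
    γ.timeIndex x = n := by
  obtain ⟨y, ⟨hy, hyn⟩, hxy⟩ := hn
  rw [← hyn, eq_of_apply_eq_of_notMem hy.1 hx.1 hxy (H.notMem_doublePoints hy)]

theorem arc_subset (H : IsSplittingData γ Δ m coherent l r arc) (p : γ.doublePoints) (e : Bool) :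
    arc p e ⊆ m p := by
  rw [← (H.local_splitting p).union_arc]
  cases e
  exacts [subset_union_left, subset_union_right]

open ChordDiagram in
/-- The class of a position in `{0, …, 2d}` under the group generated by the joins. -/
abbrev _root_.SurfaceCurve.PositionClass (γ : SurfaceCurve S) (coherent : γ.doublePoints → Prop) :
    Type :=
  MulAction.orbitRel.Quotient (Subgroup.closure (⋃ p : γ.doublePoints,
    joins γ.numDoublePoints (γ.timeIndex (γ.time p false)) (γ.timeIndex (γ.time p true))
      (coherent p))) (Fin (2 * γ.numDoublePoints + 1))

/-- The class of the position `n`. -/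
noncomputable def _root_.SurfaceCurve.positionClass (γ : SurfaceCurve S) (coherent : γ.doublePoints → Prop)
    (n : ℕ) : γ.PositionClass coherent :=
  Quotient.mk'' (Fin.ofNat (2 * γ.numDoublePoints + 1) n)

theorem positionClass_eq_of_mem_joins {p : γ.doublePoints} {i j : ℕ}
    (h : ChordDiagram.transposition γ.numDoublePoints i j ∈ ChordDiagram.joins γ.numDoublePoints
      (γ.timeIndex (γ.time p false)) (γ.timeIndex (γ.time p true)) (coherent p)) :
    γ.positionClass coherent i = γ.positionClass coherent j := by
  symm
  refine Quotient.sound' ?_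
  refine MulAction.orbitRel_apply.2 ⟨⟨_, Subgroup.subset_closure (mem_iUnion.2 ⟨p, h⟩)⟩, ?_⟩
  exact Equiv.swap_apply_left _ _

/-- The pieces of a split curve: parts of the curve, and arcs in the discs. -/
def _root_.SurfaceCurve.piece (γ : SurfaceCurve S) (l r : γ.doublePoints → Bool → ℝ)
    (arc : γ.doublePoints → Bool → Set S) :
    Fin (2 * γ.numDoublePoints + 1) ⊕ γ.doublePoints × Bool → Set S
  | .inl n => γ.outerPiece l r n
  | .inr z => arc z.1 z.2

/-- The class of positions to which a piece belongs. -/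
noncomputable def _root_.SurfaceCurve.pieceClass (γ : SurfaceCurve S) (coherent : γ.doublePoints → Prop) :
    Fin (2 * γ.numDoublePoints + 1) ⊕ γ.doublePoints × Bool → γ.PositionClass coherent
  | .inl n => γ.positionClass coherent n
  | .inr (p, false) => γ.positionClass coherent (γ.timeIndex (γ.time p false) - 1)
  | .inr (p, true) => γ.positionClass coherent (γ.timeIndex (γ.time p false))

/-- The four points at which the curve enters or leaves the disc around `p` belong to the arcs, and
to the pieces of the curve of the right class. -/
theorem exists_end_mem_arc (H : IsSplittingData γ Δ m coherent l r arc)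
    (hfin : γ.doublePoints.Finite) (p : γ.doublePoints) {x : ℝ} {b : Bool}
    (hx : x = l p b ∨ x = r p b) :
    ∃ e, γ.toFun x ∈ arc p e ∧
      γ.positionClass coherent (γ.timeIndex x) = γ.pieceClass coherent (.inr (p, e)) := by
  have L := H.local_splitting p
  -- The entry and exit of the first passage have the class of their arc by definition of
  -- `pieceClass`. For those of the second passage the class is moved by one of the two
  -- transpositions in `joins`.
  by_cases hc : coherent p
  · rcases hx with rfl | rfl <;> cases b
    · exact ⟨false, L.left_false, by rw [H.timeIndex_left hfin]; rfl⟩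
    · refine ⟨true, (L.of_coherent hc).1, ?_⟩
      rw [H.timeIndex_left hfin]
      exact (positionClass_eq_of_mem_joins (p := p) (Or.inl ⟨hc, Or.inl rfl⟩)).symm
    · exact ⟨true, L.right_false, by rw [H.timeIndex_right]; rfl⟩
    · refine ⟨false, (L.of_coherent hc).2, ?_⟩
      rw [H.timeIndex_right]
      exact (positionClass_eq_of_mem_joins (p := p) (Or.inl ⟨hc, Or.inr rfl⟩)).symm
  · rcases hx with rfl | rfl <;> cases b
    · exact ⟨false, L.left_false, by rw [H.timeIndex_left hfin]; rfl⟩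
    · refine ⟨false, (L.of_not_coherent hc).1, ?_⟩
      rw [H.timeIndex_left hfin]
      exact (positionClass_eq_of_mem_joins (p := p) (Or.inr ⟨hc, Or.inr rfl⟩)).symm
    · exact ⟨true, L.right_false, by rw [H.timeIndex_right]; rfl⟩
    · refine ⟨true, (L.of_not_coherent hc).2, ?_⟩
      rw [H.timeIndex_right]
      exact (positionClass_eq_of_mem_joins (p := p) (Or.inr ⟨hc, Or.inl rfl⟩)).symm

theorem arc_index_unique (H : IsSplittingData γ Δ m coherent l r arc) {p q : γ.doublePoints}
    {e f : Bool} {x : S} (h : x ∈ arc p e) (h' : x ∈ arc q f) : (p, e) = (q, f) := by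
  have hpq : p = q := by
    by_contra hne
    exact Set.disjoint_left.1 (H.disjoint p q hne) (H.subset p (H.arc_subset p e h))
      (H.subset q (H.arc_subset q f h'))
  subst hpq
  have hd := Set.disjoint_left.1 (H.local_splitting p).disjoint_arc
  cases e <;> cases f
  exacts [rfl, absurd h' (hd h), absurd h (hd h'), rfl]

/-- An outer piece meets a disc only at entry or exit points, and such a point lies on a single arc.
-/
theorem pieceClass_eq_of_mem (H : IsSplittingData γ Δ m coherent l r arc)
    (hfin : γ.doublePoints.Finite) {n : Fin (2 * γ.numDoublePoints + 1)} {p : γ.doublePoints}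
    {e : Bool} {x : S} (hn : x ∈ γ.outerPiece l r n) (he : x ∈ arc p e) :
    γ.pieceClass coherent (.inl n) = γ.pieceClass coherent (.inr (p, e)) := by
  obtain ⟨y, ⟨hy, hyn⟩, rfl⟩ := hn
  obtain ⟨b, hb⟩ := H.eq_left_or_right hy (H.subset p (H.arc_subset p e he))
  obtain ⟨f, hf, hcl⟩ := H.exists_end_mem_arc hfin p hb
  rw [H.arc_index_unique he hf, ← hcl, hyn]
  rfl

theorem pieceClass_eq_of_nonempty (H : IsSplittingData γ Δ m coherent l r arc)
    (hfin : γ.doublePoints.Finite) (i j : Fin (2 * γ.numDoublePoints + 1) ⊕ γ.doublePoints × Bool)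
    (h : (γ.piece l r arc i ∩ γ.piece l r arc j).Nonempty) :
    γ.pieceClass coherent i = γ.pieceClass coherent j := by
  obtain ⟨x, hi, hj⟩ := h
  rcases i with n | ⟨p, e⟩ <;> rcases j with k | ⟨q, f⟩
  · obtain ⟨y, ⟨hy, hyn⟩, rfl⟩ := hi
    have := H.timeIndex_eq_of_mem_outerPiece hy hj
    rw [Fin.ext (hyn.symm.trans this)]
  · exact H.pieceClass_eq_of_mem hfin hi hj
  · exact (H.pieceClass_eq_of_mem hfin hj hi).symm
  · rw [H.arc_index_unique hi hj]

/-- Each generating transposition exchanges two positions whose outer pieces have ends on a common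
arc. So the generators, and by induction the whole group, preserve the relation; and each arc meets
some outer piece. -/
theorem eqvGen_of_pieceClass_eq (H : IsSplittingData γ Δ m coherent l r arc)
    (hfin : γ.doublePoints.Finite) (i j : Fin (2 * γ.numDoublePoints + 1) ⊕ γ.doublePoints × Bool)
    (h : γ.pieceClass coherent i = γ.pieceClass coherent j) :
    Relation.EqvGen (fun i j => (γ.piece l r arc i ∩ γ.piece l r arc j).Nonempty) i j := by
  set R := Relation.EqvGen (fun i j => (γ.piece l r arc i ∩ γ.piece l r arc j).Nonempty) with hR
  have hRsymm : ∀ {a b}, R a b → R b a := fun h => Relation.EqvGen.symm _ _ h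
  have hRtrans : ∀ {a b c}, R a b → R b c → R a c := fun h h' => Relation.EqvGen.trans _ _ _ h h'
  let N := 2 * γ.numDoublePoints + 1
  have hval : ∀ x : ℝ, ((Fin.ofNat N (γ.timeIndex x) : Fin N) : ℕ) = γ.timeIndex x := fun x => by
    rw [Fin.val_ofNat, Nat.mod_eq_of_lt (Nat.lt_succ_of_le (timeIndex_le hfin x))]
  -- an end of a piece of the curve meets the arc that contains it
  have hmeet : ∀ (p : γ.doublePoints) (e : Bool) (x : ℝ), x ∈ γ.outerTimes l r →
      γ.toFun x ∈ arc p e → R (.inl (Fin.ofNat N (γ.timeIndex x))) (.inr (p, e)) := by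
    intro p e x hx he
    refine Relation.EqvGen.rel _ _ ⟨γ.toFun x, ⟨x, ⟨hx, (hval x).symm⟩, rfl⟩, he⟩
  have hjoin : ∀ (p : γ.doublePoints) (e : Bool) (x y : ℝ), x ∈ γ.outerTimes l r →
      y ∈ γ.outerTimes l r → γ.toFun x ∈ arc p e → γ.toFun y ∈ arc p e →
      R (.inl (Fin.ofNat N (γ.timeIndex x))) (.inl (Fin.ofNat N (γ.timeIndex y))) :=
    fun p e x y hx hy hxe hye => hRtrans (hmeet p e x hx hxe) (hRsymm (hmeet p e y hy hye))
  have hswap : ∀ a b : Fin N, R (.inl a) (.inl b) → ∀ n : Fin N,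
      R (.inl n) (.inl (Equiv.swap a b n)) := by
    intro a b hab n
    rcases eq_or_ne n a with rfl | hna
    · rwa [Equiv.swap_apply_left]
    rcases eq_or_ne n b with rfl | hnb
    · rw [Equiv.swap_apply_right]; exact hRsymm hab
    · rw [Equiv.swap_apply_of_ne_of_ne hna hnb]; exact Relation.EqvGen.refl _
  have hgen : ∀ p : γ.doublePoints, ∀ g ∈ ChordDiagram.joins γ.numDoublePoints
      (γ.timeIndex (γ.time p false)) (γ.timeIndex (γ.time p true)) (coherent p),
      ∀ n : Fin N, R (.inl n) (.inl (g n)) := by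
    intro p g hg
    have L := H.local_splitting p
    have hl := H.left_mem_outerTimes p
    have hr := H.right_mem_outerTimes p
    -- The four letters become the indices of the entry and exit times.
    rw [ChordDiagram.joins, ← H.timeIndex_left hfin, ← H.timeIndex_left hfin, ← H.timeIndex_right,
      ← H.timeIndex_right] at hg
    rcases hg with ⟨hc, rfl | rfl⟩ | ⟨hc, rfl | rfl⟩
    · exact hswap _ _ (hjoin p true _ _ (hr _) (hl _) L.right_false (L.of_coherent hc).1)
    · exact hswap _ _ (hjoin p false _ _ (hl _) (hr _) L.left_false (L.of_coherent hc).2)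
    · exact hswap _ _ (hjoin p true _ _ (hr _) (hr _) L.right_false (L.of_not_coherent hc).2)
    · exact hswap _ _ (hjoin p false _ _ (hl _) (hl _) L.left_false (L.of_not_coherent hc).1)
  have hclosure : ∀ g ∈ Subgroup.closure (⋃ p : γ.doublePoints,
      ChordDiagram.joins γ.numDoublePoints (γ.timeIndex (γ.time p false))
        (γ.timeIndex (γ.time p true)) (coherent p)), ∀ n : Fin N, R (.inl n) (.inl (g n)) := by
    intro g hg
    induction hg using Subgroup.closure_induction with
    | mem g hg =>
      obtain ⟨p, hp⟩ := mem_iUnion.1 hg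
      exact hgen p g hp
    | one => exact fun n => Relation.EqvGen.refl _
    | mul g g' _ _ h h' => exact fun n => hRtrans (h' n) (h (g' n))
    | inv g _ h =>
      intro n
      have := h (g⁻¹ n)
      rw [show g (g⁻¹ n) = n by simp] at this
      exact hRsymm this
  have hinl : ∀ a b : Fin N, γ.pieceClass coherent (.inl a) = γ.pieceClass coherent (.inl b) →
      R (.inl a) (.inl b) := by
    intro a b hab
    have hab' := Quotient.exact' hab
    rw [MulAction.orbitRel_apply] at hab'
    obtain ⟨⟨g, hg⟩, hgb⟩ := hab'
    have := hclosure g hg b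
    have e : g b = a := by
      simpa using hgb
    rw [e] at this
    exact hRsymm this
  -- every piece is related to a piece of the curve of the same class
  have hrep : ∀ i, ∃ n : Fin N, R i (.inl n) ∧
      γ.pieceClass coherent i = γ.pieceClass coherent (.inl n) := by
    rintro (n | ⟨p, e⟩)
    · exact ⟨n, Relation.EqvGen.refl _, rfl⟩
    · have L := H.local_splitting p
      have : ∃ x ∈ γ.outerTimes l r, γ.toFun x ∈ arc p e := by
        cases e
        exacts [⟨_, H.left_mem_outerTimes p false, L.left_false⟩,
          ⟨_, H.right_mem_outerTimes p false, L.right_false⟩]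
      obtain ⟨x, hx, he⟩ := this
      have hRx := hmeet p e x hx he
      refine ⟨_, hRsymm hRx, (H.pieceClass_eq_of_mem hfin (x := γ.toFun x) ?_ he).symm⟩
      exact ⟨x, ⟨hx, (hval x).symm⟩, rfl⟩
  obtain ⟨a, ha, ha'⟩ := hrep i
  obtain ⟨b, hb, hb'⟩ := hrep j
  exact hRtrans ha (hRtrans (hinl a b (ha'.symm.trans (h.trans hb'))) (hRsymm hb))

/-- The number of components of a split curve is the number of classes of positions. -/
theorem card_connectedComponents [T2Space S] (H : IsSplittingData γ Δ m coherent l r arc)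
    (hfin : γ.doublePoints.Finite) {E : Set S}
    (hout : ∀ x, (∀ p, x ∉ Δ p) → (x ∈ E ↔ x ∈ γ.toFun '' Icc (0 : ℝ) 1))
    (hin : ∀ p, E ∩ Δ p = m p) :
    Nat.card (ConnectedComponents E) = Nat.card (γ.PositionClass coherent) := by
  have hE : E = ⋃ i, γ.piece l r arc i := by
    ext x
    constructor
    · intro hx
      by_cases hd : ∃ p, x ∈ Δ p
      · obtain ⟨p, hp⟩ := hd
        have : x ∈ m p := by rw [← hin p]; exact ⟨hx, hp⟩
        rw [← (H.local_splitting p).union_arc] at this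
        rcases this with h | h
        exacts [mem_iUnion.2 ⟨.inr (p, false), h⟩, mem_iUnion.2 ⟨.inr (p, true), h⟩]
      · push Not at hd
        obtain ⟨s, hs, rfl⟩ := (hout x hd).1 hx
        refine mem_iUnion.2 ⟨.inl ⟨γ.timeIndex s, Nat.lt_succ_of_le (timeIndex_le hfin s)⟩,
          s, ⟨⟨hs, fun p b h => ?_⟩, rfl⟩, rfl⟩
        exact hd p (H.mem_of_mem_Icc (Ioo_subset_Icc_self h)).2
    · intro hx
      have harc : ∀ p e, arc p e ⊆ E := fun p e y hy => by
        have := H.arc_subset p e hy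
        rw [← hin p] at this
        exact this.1
      obtain ⟨n | ⟨p, e⟩, hi⟩ := mem_iUnion.1 hx
      · obtain ⟨y, ⟨hy, -⟩, rfl⟩ := hi
        -- An outer point in a disc is an entry or exit, hence lies on an arc.
        by_cases hd : ∃ p, γ.toFun y ∈ Δ p
        · obtain ⟨p, hp⟩ := hd
          obtain ⟨b, hb⟩ := H.eq_left_or_right hy hp
          obtain ⟨e, he, -⟩ := H.exists_end_mem_arc hfin p hb
          exact harc p e he
        · push Not at hd
          exact (hout _ hd).2 ⟨y, hy.1, rfl⟩
      · exact harc p e hi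
  have := hfin.to_subtype
  rw [hE]
  refine card_connectedComponents_iUnion _ ?_ ?_ (γ.pieceClass coherent) ?_
    (H.pieceClass_eq_of_nonempty hfin) (H.eqvGen_of_pieceClass_eq hfin)
  · rintro (n | ⟨p, e⟩)
    exacts [(H.isCompact_outerPiece hfin n).isClosed,
      ((H.local_splitting p).isCompact_arc e).isClosed]
  · rintro (n | ⟨p, e⟩)
    exacts [H.isConnected_outerPiece hfin (Nat.le_of_lt_succ n.2),
      (H.local_splitting p).isConnected_arc e]
  · intro q
    obtain ⟨n, rfl⟩ := Quotient.exists_rep q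
    refine ⟨.inl n, ?_⟩
    change Quotient.mk'' _ = Quotient.mk'' _
    congr 1
    exact Fin.ext (by rw [Fin.val_ofNat, Nat.mod_eq_of_lt n.2])

end IsSplittingData

/-- The number of components of a splitting of the diagram of a curve. -/
theorem card_connectedComponents_of_isSplitting [IsManifold (𝓡∂ 2) ∞ S] [T2Space S]
    {o : SurfaceOrientation S} {s : γ.diagram.State} {E : Set S}
    (h : γ.diagram.IsSplitting o s E) :
    Nat.card (ConnectedComponents E) =
      Nat.card (γ.PositionClass fun p => γ.IsCoherent o p (s p)) := by
  obtain ⟨φ, hφ, hdisj, hout, hin⟩ := h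
  choose m hm hmE using hin
  have hcenter : ∀ p, (p : S) ∈ LinkDiagram.disc (φ p) := fun p =>
    (LinkDiagram.mem_disc_iff (hφ p).square_subset).2
      ⟨(hφ p).mem_source, by rw [(hφ p).map_center]; exact zero_mem_modelSquare⟩
  have hloc : ∀ p : γ.diagram.crossings, ∃ l r arc, IsLocalSplitting γ p (LinkDiagram.disc (φ p))
      ((φ p).symm '' m p) (γ.IsCoherent o p (s p)) l r arc := fun p => by
    refine exists_isLocalSplitting p.2 (hφ p) (fun q hq hqd => ?_) (hm p)
    by_contra hne
    -- Every double point lies in its own disc, and the discs are disjoint.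
    exact Set.disjoint_left.1 (hdisj ⟨q, hq⟩ p fun h => hne (congrArg Subtype.val h))
      (hcenter ⟨q, hq⟩) hqd
  choose l r arc H using hloc
  exact IsSplittingData.card_connectedComponents (Δ := fun p => LinkDiagram.disc (φ p))
    ⟨H, hdisj, fun p => image_mono (hm p).subset_modelSquare⟩ finite_doublePoints hout hmE

end SurfaceCurve

/-! ### The chord diagram of a curve -/

theorem ChordDiagram.writhe_eq_finsum {C : Set (ℕ × ℕ)} (hC : C.Finite) :
    ChordDiagram.writhe C = ∑ᶠ c : C, if (c : ℕ × ℕ).1 < (c : ℕ × ℕ).2 then (1 : ℤ) else -1 := by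
  obtain ⟨F, rfl⟩ := hC.exists_finset_coe
  rw [finsum_set_coe_eq_finsum_mem (f := fun c : ℕ × ℕ => if c.1 < c.2 then (1 : ℤ) else -1),
    finsum_mem_coe_finset, Finset.sum_ite, ChordDiagram.writhe]
  have h : ∀ P : ℕ × ℕ → Prop, [DecidablePred P] →
      {c ∈ (F : Set (ℕ × ℕ)) | P c}.ncard = (F.filter P).card := fun P _ => by
    rw [← ncard_coe_finset, Finset.coe_filter]; rfl
  rw [h, h]
  simp [sub_eq_add_neg]

theorem ChordDiagram.transposition_comm (d k l : ℕ) :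
    ChordDiagram.transposition d k l = ChordDiagram.transposition d l k :=
  Equiv.swap_comm _ _

namespace SurfaceCurve

variable {S : Type*} [TopologicalSpace S] [ChartedSpace (EuclideanHalfSpace 2) S]
  [IsManifold (𝓡∂ 2) ∞ S] {γ : SurfaceCurve S} {o : SurfaceOrientation S}

open Classical in
/-- The chord of a double point. -/
noncomputable def chord (γ : SurfaceCurve S) (o : SurfaceOrientation S) (p : S) : ℕ × ℕ :=
  if γ.IsPositive o p then (γ.timeIndex (γ.firstTime p), γ.timeIndex (γ.lastTime p))
  else (γ.timeIndex (γ.lastTime p), γ.timeIndex (γ.firstTime p))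

theorem chord_lt_iff (hfin : γ.doublePoints.Finite) {p : S} (hp : p ∈ γ.doublePoints) :
    (γ.chord o p).1 < (γ.chord o p).2 ↔ γ.IsPositive o p := by
  have := timeIndex_firstTime_lt hfin hp
  by_cases h : γ.IsPositive o p
  · simp [chord, h, this]
  · simp [chord, h, this.le]

/-- Of the two orders of the transverse velocities exactly one is positive, so each double point
yields one chord. -/
theorem mem_chordDiagram_iff {c : ℕ × ℕ} :
    c ∈ γ.chordDiagram o ↔ ∃ p ∈ γ.doublePoints, γ.chord o p = c := by
  constructor
  · rintro ⟨t, ht, u, hu, htc, huc, htu, hpos⟩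
    have hne : t ≠ u := by
      rintro rfl
      have := hpos.linearIndependent.injective.ne (show (0 : Fin 2) ≠ 1 by decide)
      exact this rfl
    refine ⟨γ.toFun t, ht.2, ?_⟩
    rcases eq_firstTime_or_lastTime ht.2 ht.1 rfl with h | h <;>
      rcases eq_firstTime_or_lastTime ht.2 hu.1 htu.symm with h' | h'
    · exact absurd (h.trans h'.symm) hne
    · have hP : γ.IsPositive o (γ.toFun t) := by
        rw [IsPositive, ← h, ← h']; exact hpos
      rw [chord, if_pos hP, ← h, ← h', htc, huc]
    · have hP : ¬ γ.IsPositive o (γ.toFun t) := by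
        refine (isPositivePair_velocity_swap_iff o ht.2).1 ?_
        rw [← h, ← h']; exact hpos
      rw [chord, if_neg hP, ← h, ← h', htc, huc]
    · exact absurd (h.trans h'.symm) hne
  · rintro ⟨p, hp, rfl⟩
    have hf := apply_firstTime hp
    have hl := apply_lastTime hp
    by_cases h : γ.IsPositive o p
    · refine ⟨_, time_mem_doubleTimes hp false, _, time_mem_doubleTimes hp true, ?_, ?_,
        hf.trans hl.symm, ?_⟩
      · rw [chord, if_pos h]; rfl
      · rw [chord, if_pos h]; rfl
      · change IsPositivePair (o.at' (γ.toFun (γ.firstTime p))) _ _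
        rw [hf]; exact h
    · refine ⟨_, time_mem_doubleTimes hp true, _, time_mem_doubleTimes hp false, ?_, ?_,
        hl.trans hf.symm, ?_⟩
      · rw [chord, if_neg h]; rfl
      · rw [chord, if_neg h]; rfl
      · change IsPositivePair (o.at' (γ.toFun (γ.lastTime p))) _ _
        rw [hl]; exact (isPositivePair_velocity_swap_iff o hp).2 h

/-- Whatever the sign, the smaller entry is the index of the first time, which determines the point.
-/
theorem chord_injOn (hfin : γ.doublePoints.Finite) : InjOn (γ.chord o) γ.doublePoints := by
  intro p hp q hq h
  have hmin : ∀ x ∈ γ.doublePoints, min (γ.chord o x).1 (γ.chord o x).2 =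
      γ.timeIndex (γ.firstTime x) := by
    intro x hx
    have := (timeIndex_firstTime_lt hfin hx).le
    by_cases h : γ.IsPositive o x
    · simp [chord, h, this]
    · simp [chord, h, this]
  have h' : γ.timeIndex (γ.firstTime p) = γ.timeIndex (γ.firstTime q) := by
    rw [← hmin p hp, ← hmin q hq, h]
  have := (timeIndex_strictMonoOn hfin).injOn (time_mem_doubleTimes hp false)
    (time_mem_doubleTimes hq false) h'
  rw [← apply_time hp false, this, apply_time hq]

theorem chordDiagram_eq_image : γ.chordDiagram o = γ.chord o '' γ.doublePoints := by
  ext c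
  exact mem_chordDiagram_iff

theorem isOrientedLinearChordDiagram (hfin : γ.doublePoints.Finite) :
    IsOrientedLinearChordDiagram γ.numDoublePoints (γ.chordDiagram o) := by
  rw [chordDiagram_eq_image]
  refine ⟨hfin.image _, (chord_injOn hfin).ncard_image, ?_⟩
  rw [← image_timeIndex hfin]
  ext n
  constructor
  · rintro (⟨_, ⟨p, hp, rfl⟩, rfl⟩ | ⟨_, ⟨p, hp, rfl⟩, rfl⟩) <;> rw [chord] <;> split_ifs
    exacts [⟨_, time_mem_doubleTimes hp false, rfl⟩, ⟨_, time_mem_doubleTimes hp true, rfl⟩,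
      ⟨_, time_mem_doubleTimes hp true, rfl⟩, ⟨_, time_mem_doubleTimes hp false, rfl⟩]
  · rintro ⟨τ, hτ, rfl⟩
    have hm : γ.chord o (γ.toFun τ) ∈ γ.chord o '' γ.doublePoints := ⟨_, hτ.2, rfl⟩
    obtain ⟨b, hb⟩ := exists_eq_time hτ
    by_cases h : γ.IsPositive o (γ.toFun τ)
    · cases b
      · refine Or.inl ⟨_, hm, ?_⟩
        rw [chord, if_pos h]; exact congrArg γ.timeIndex hb.symm
      · refine Or.inr ⟨_, hm, ?_⟩
        rw [chord, if_pos h]; exact congrArg γ.timeIndex hb.symm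
    · cases b
      · refine Or.inr ⟨_, hm, ?_⟩
        rw [chord, if_neg h]; exact congrArg γ.timeIndex hb.symm
      · refine Or.inl ⟨_, hm, ?_⟩
        rw [chord, if_neg h]; exact congrArg γ.timeIndex hb.symm

/-- Crossings correspond to chords. -/
noncomputable def crossingEquivChord (hfin : γ.doublePoints.Finite) :
    γ.diagram.crossings ≃ γ.chordDiagram o :=
  (Equiv.Set.imageOfInjOn (γ.chord o) γ.doublePoints (chord_injOn hfin)).trans
    (Equiv.setCongr chordDiagram_eq_image.symm)

theorem coe_crossingEquivChord (hfin : γ.doublePoints.Finite) (p : γ.diagram.crossings) :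
    (crossingEquivChord (o := o) hfin p : ℕ × ℕ) = γ.chord o p := rfl

/-- For a negative point the entries of the chord are exchanged. This permutes $(i,j-1)$ and
$(i-1,j)$ and fixes $(i,j)$ and $(i-1,j-1)$. -/
theorem R_chord (hfin : γ.doublePoints.Finite) {p : S} (hp : p ∈ γ.doublePoints) (d : ℕ)
    (σ : SplitType) :
    ChordDiagram.R d (γ.chord o p) σ = ChordDiagram.joins d (γ.timeIndex (γ.time p false))
      (γ.timeIndex (γ.time p true)) (γ.IsCoherent o p σ) := by
  change _ = ChordDiagram.joins d (γ.timeIndex (γ.firstTime p))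
      (γ.timeIndex (γ.lastTime p)) (γ.IsCoherent o p σ)
  have hiff : ((σ = SplitType.A ∧ (γ.chord o p).1 < (γ.chord o p).2) ∨
      (σ = SplitType.B ∧ ¬ (γ.chord o p).1 < (γ.chord o p).2)) ↔ γ.IsCoherent o p σ := by
    rw [chord_lt_iff hfin hp]; rfl
  ext g
  by_cases hc : γ.IsCoherent o p σ
  · rw [ChordDiagram.R, if_pos (hiff.2 hc)]
    simp only [ChordDiagram.joins, hc, mem_insert_iff, mem_singleton_iff, true_and, not_true,
      false_and, or_false, mem_ofPred_eq]
    by_cases h : γ.IsPositive o p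
    · simp only [chord, if_pos h]
    · simp only [chord, if_neg h]
      rw [or_comm, ChordDiagram.transposition_comm d (γ.timeIndex (γ.lastTime p)),
        ChordDiagram.transposition_comm d (γ.timeIndex (γ.lastTime p) - 1)]
  · rw [ChordDiagram.R, if_neg (fun h => hc (hiff.1 h))]
    simp only [ChordDiagram.joins, hc, mem_insert_iff, mem_singleton_iff, not_false_eq_true,
      true_and, false_and, false_or, mem_ofPred_eq]
    by_cases h : γ.IsPositive o p
    · simp only [chord, if_pos h]
    · simp only [chord, if_neg h]
      rw [ChordDiagram.transposition_comm d (γ.timeIndex (γ.lastTime p)),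
        ChordDiagram.transposition_comm d (γ.timeIndex (γ.lastTime p) - 1)]

theorem orbitCount_eq (hfin : γ.doublePoints.Finite) (s : γ.diagram.State) :
    ChordDiagram.orbitCount γ.numDoublePoints (γ.chordDiagram o)
        (s ∘ (crossingEquivChord hfin).symm) =
      Nat.card (γ.PositionClass fun p => γ.IsCoherent o p (s p)) := by
  have : (⋃ c : γ.chordDiagram o, ChordDiagram.R γ.numDoublePoints (c : ℕ × ℕ)
      ((s ∘ (crossingEquivChord hfin).symm) c)) =
      ⋃ p : γ.doublePoints, ChordDiagram.joins γ.numDoublePoints (γ.timeIndex (γ.time p false))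
        (γ.timeIndex (γ.time p true)) (γ.IsCoherent o p (s p)) := by
    rw [← (crossingEquivChord (o := o) hfin).surjective.iUnion_comp]
    refine iUnion_congr fun p => ?_
    rw [Function.comp_apply, Equiv.symm_apply_apply, coe_crossingEquivChord]
    exact R_chord hfin p.2 _ _
  rw [ChordDiagram.orbitCount, this]

/-! ### Comparison of the two polynomials. -/

variable [T2Space S]

/-- The choice made by `Classical.epsilon` is meaningful only because a splitting exists. -/
theorem isSplitting_split (o : SurfaceOrientation S) (s : γ.diagram.State) :
    γ.diagram.IsSplitting o s (γ.diagram.split o s) :=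
  Classical.epsilon_spec (exists_isSplitting o s)

theorem mu_eq (s : γ.diagram.State) :
    γ.diagram.mu o s = Nat.card (γ.PositionClass fun p => γ.IsCoherent o p (s p)) :=
  card_connectedComponents_of_isSplitting (isSplitting_split o s)

theorem mu_pos (s : γ.diagram.State) : 0 < γ.diagram.mu o s := by
  rw [mu_eq]
  have : Nonempty (γ.PositionClass fun p => γ.IsCoherent o p (s p)) :=
    ⟨γ.positionClass _ 0⟩
  have : Finite (γ.PositionClass fun p => γ.IsCoherent o p (s p)) :=
    Quotient.finite _
  exact Nat.card_pos

/-- States are transported along the bijection from crossings to chords, and the summands agree one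
by one. -/
theorem bracket_diagram :
    γ.diagram.bracket o = ChordDiagram.bracket γ.numDoublePoints (γ.chordDiagram o) := by
  have hfin := finite_doublePoints (γ := γ)
  let e := crossingEquivChord (γ := γ) (o := o) hfin
  refine finsum_eq_of_bijective (fun s : γ.diagram.State => s ∘ e.symm)
    (e.symm.arrowCongr (Equiv.refl _)).symm.bijective fun s => ?_
  have hcard : ∀ σ : SplitType, Nat.card {p : γ.diagram.crossings // s p = σ} =
      Nat.card {c : γ.chordDiagram o // (s ∘ e.symm) c = σ} := fun σ =>
    Nat.card_congr (e.subtypeEquiv fun p => by simp)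
  rw [ChordDiagram.stateBracket, ← hcard, ← hcard, orbitCount_eq hfin, ← mu_eq]
  rfl

theorem writhe_diagram : γ.diagram.writhe o = ChordDiagram.writhe (γ.chordDiagram o) := by
  have hfin := finite_doublePoints (γ := γ)
  rw [ChordDiagram.writhe_eq_finsum (isOrientedLinearChordDiagram hfin).1]
  refine finsum_eq_of_bijective _ (crossingEquivChord (γ := γ) (o := o) hfin).bijective fun p => ?_
  rw [coe_crossingEquivChord, LinkDiagram.crossingSign]
  have h' := chord_lt_iff (o := o) hfin p.2
  by_cases h : γ.IsPositive o p
  · rw [if_pos (h'.2 h)]; exact if_pos h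
  · rw [if_neg (mt h'.1 h)]; exact if_neg h

theorem jones_diagram :
    γ.diagram.jones o = ChordDiagram.jones γ.numDoublePoints (γ.chordDiagram o) := by
  rw [LinkDiagram.jones, ChordDiagram.jones, writhe_diagram, bracket_diagram]

end SurfaceCurve

theorem mainTheorem5 {S : Type*} [TopologicalSpace S] [T2Space S]
    [ChartedSpace (EuclideanHalfSpace 2) S] [IsManifold (𝓡∂ 2) ∞ S]
    (o : SurfaceOrientation S) (γ : SurfaceCurve S) :
    -- the curve has finitely many double points and `C_γ` is a chord diagram of `d(γ)` chords
    γ.doublePoints.Finite ∧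
    IsOrientedLinearChordDiagram γ.numDoublePoints (γ.chordDiagram o) ∧
    -- `D_γ(s)` exists, and `μ(s)` is positive and does not depend on how the splitting is made
    (∀ s : γ.diagram.State,
      (∃ E : Set S, γ.diagram.IsSplitting o s E) ∧
      0 < γ.diagram.mu o s ∧
      ∀ E : Set S, γ.diagram.IsSplitting o s E →
        Nat.card (ConnectedComponents E) = γ.diagram.mu o s) ∧
    -- the two formulas
    γ.diagram.bracket o = ChordDiagram.bracket γ.numDoublePoints (γ.chordDiagram o) ∧
    γ.diagram.jones o = ChordDiagram.jones γ.numDoublePoints (γ.chordDiagram o) :=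
  ⟨SurfaceCurve.finite_doublePoints,
    SurfaceCurve.isOrientedLinearChordDiagram SurfaceCurve.finite_doublePoints,
    fun s => ⟨SurfaceCurve.exists_isSplitting o s, SurfaceCurve.mu_pos s, fun _ hE =>
      (SurfaceCurve.card_connectedComponents_of_isSplitting hE).trans
        (SurfaceCurve.mu_eq s).symm⟩,
    SurfaceCurve.bracket_diagram, SurfaceCurve.jones_diagram⟩
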